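/- An instance $\varphi$ of $(3,4)$-SAT with $n$ variables $x_0,\dots,x_{n-1}$ is a CNF formula in which every clause consists of three literals over three different variables and every variable occurs in at most four clauses. An instance $(G,L)$ of List Edge Coloring in Simple Graphs is a finite simple graph $G$ together with a finite list $L(e)\subset\mathbb{N}$ for every edge $e$; a list edge coloring of $(G,L)$ is a function $c\colon E(G)\to\mathbb{N}$ with $c(e)\in L(e)$ for every edge $e$ and $c(e)\neq c(f)$ for any two distinct edges $e,f$ that share an endpoint. There is a polynomial-time algorithm that transforms every $(3,4)$-SAT instance $\varphi$ with $n$ variables into an instance $(G,L)$ of List Edge Coloring in Simple Graphs such that 1. $\varphi$ is satisfiable if and only if $(G,L)$ has a list edge coloring; 2. $|V(G)| = O(\sqrt{n})$, that is, there is an absolute constant $K$ with $|V(G)|\le K\sqrt n$ for all $\varphi$ with $n\ge 1$ variables; 3. $V(G)$ is partitioned into $63$ layers $L_0,\dots,L_{62}$ such that no edge joins two vertices of the same layer, and, when the colors $2i$ and $2i+1$ are denoted by $x_i$ and $\neg x_i$ respectively, for every list edge coloring $c$ of $(G,L)$ and every $i\in\{0,\dots,n-1\}$ the edges $e$ with $c(e)\in\{x_i,\neg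 x_i\}$ are exactly the edges of a path from $L_0$ to $L_{62}$ that has exactly one vertex in each layer and on which the colors $x_i$ and $\neg x_i$ alternate. Here the running time is the number of steps of a random access machine with unit-cost addition and subtraction, and it is bounded by a polynomial in $n$. -/

import Mathlib

/-! ### (3,4)-SAT -/

/-- An instance of (3,4)-SAT with variables `x_0, …, x_{numVars-1}`. A literal is a variable together
with a sign (`true` for `x_i`, `false` for `¬ x_i`). Every clause consists of three literals over
three different variables, and every variable occurs in at most four clauses. -/
structure ThreeFourSAT where
  numVars : ℕ
  clauses : List (Fin 3 → Fin numVars × Bool)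
  three_variables : ∀ C ∈ clauses, Function.Injective fun j => (C j).1
  at_most_four : ∀ x : Fin numVars,
    clauses.countP (fun C => decide (∃ j, (C j).1 = x)) ≤ 4

namespace ThreeFourSAT

/-- Some truth assignment makes at least one literal of every clause true. -/
def Satisfiable (φ : ThreeFourSAT) : Prop :=
  ∃ f : Fin φ.numVars → Bool, ∀ C ∈ φ.clauses, ∃ j, f (C j).1 = (C j).2

/-- The number that stands for a literal: `2 i` for `x_i` and `2 i + 1` for `¬ x_i`. -/
def literalCode {n : ℕ} (l : Fin n × Bool) : ℕ :=
  2 * (l.1 : ℕ) + if l.2 then 0 else 1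

/-- The formula written as a sequence of numbers: the number of variables, the number of clauses,
and then the three literals of each clause. -/
def word (φ : ThreeFourSAT) : List ℕ :=
  φ.numVars :: φ.clauses.length ::
    φ.clauses.flatMap fun C => List.ofFn fun j => literalCode (C j)

end ThreeFourSAT

/-! ### List Edge Coloring in simple graphs -/

/-- An instance of List Edge Coloring in Simple Graphs: a finite simple graph with a finite list of
allowed colors (natural numbers) for each edge. -/
structure ListEdgeColoringInstance where
  numVertices : ℕ
  graph : SimpleGraph (Fin numVertices)
  list : graph.edgeSet → Finset ℕ

namespace ListEdgeColoringInstance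

/-- `c` takes the color of each edge from its list and gives different colors to different edges
that share an endpoint. -/
def IsColoring (I : ListEdgeColoringInstance) (c : I.graph.edgeSet → ℕ) : Prop :=
  (∀ e, c e ∈ I.list e) ∧
    ∀ e f : I.graph.edgeSet, e ≠ f →
      (∃ v, v ∈ (e : Sym2 (Fin I.numVertices)) ∧ v ∈ (f : Sym2 (Fin I.numVertices))) → c e ≠ c f

/-- The instance is a YES-instance. -/
def Colorable (I : ListEdgeColoringInstance) : Prop :=
  ∃ c, I.IsColoring c

/-- The sequence of numbers `w` is a description of the instance `I`: the number of vertices,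
followed by a list of all edges without repetitions, where each edge is written as its two
endpoints, the length of its list, and the colors on its list without repetitions. -/
def IsDescribedBy (I : ListEdgeColoringInstance) (w : List ℕ) : Prop :=
  ∃ entries : List (Fin I.numVertices × Fin I.numVertices × List ℕ),
    w = I.numVertices ::
      entries.flatMap (fun t => (t.1 : ℕ) :: (t.2.1 : ℕ) :: t.2.2.length :: t.2.2) ∧
    (entries.map fun t => s(t.1, t.2.1)).Nodup ∧
    (∀ e, e ∈ I.graph.edgeSet ↔ ∃ t ∈ entries, s(t.1, t.2.1) = e) ∧
    ∀ t ∈ entries, t.2.2.Nodup ∧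
      ∀ h : s(t.1, t.2.1) ∈ I.graph.edgeSet, I.list ⟨s(t.1, t.2.1), h⟩ = t.2.2.toFinset

/-- In every list edge coloring, the edges colored `x_i` or `¬ x_i` are exactly the edges of a path
that starts in the first of the 63 layers, ends in the last one, has exactly one vertex in each
layer, and on which the two colors alternate. -/
def HasAlternatingPath (I : ListEdgeColoringInstance) (layer : Fin I.numVertices → Fin 63)
    {n : ℕ} (i : Fin n) : Prop :=
  ∀ c, I.IsColoring c →
    ∃ (u v : Fin I.numVertices) (P : I.graph.Walk u v),
      P.IsPath ∧ layer u = 0 ∧ layer v = 62 ∧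
      (∀ k : Fin 63, ∃! y, y ∈ P.support ∧ layer y = k) ∧
      (∀ e : I.graph.edgeSet, (e : Sym2 (Fin I.numVertices)) ∈ P.edges ↔
        c e = ThreeFourSAT.literalCode (i, true) ∨ c e = ThreeFourSAT.literalCode (i, false)) ∧
      ∀ (k : ℕ) (h : k + 1 < P.edges.length),
        c ⟨P.edges[k], P.edges_subset_edgeSet (List.getElem_mem _)⟩ ≠
          c ⟨P.edges[k + 1], P.edges_subset_edgeSet (List.getElem_mem h)⟩

end ListEdgeColoringInstance

/-! ### Random access machines

A program works on registers and arrays, all holding natural numbers, and appends its results to an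
output sequence. The only arithmetic operations are addition and truncated subtraction, each of
unit cost. Hence each step increases the bit length of the numbers by at most a constant that
depends on the program, and this model is polynomially equivalent to Turing machines. -/

namespace RAM

structure State where
  reg : ℕ → ℕ
  arr : ℕ → ℕ → ℕ
  out : List ℕ

/-- `read a e` is the entry of array number `a` at the index given by `e`. -/
inductive Term where
  | const (k : ℕ)
  | reg (x : ℕ)
  | read (a : ℕ) (e : Term)
  | add (e f : Term)
  | sub (e f : Term)

namespace Term

def eval (s : State) : Term → ℕ
  | const k => k
  | reg x => s.reg x
  | read a e => s.arr a (e.eval s)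
  | add e f => e.eval s + f.eval s
  | sub e f => e.eval s - f.eval s

/-- The number of elementary operations in the evaluation. -/
def cost : Term → ℕ
  | const _ => 1
  | reg _ => 1
  | read _ e => e.cost + 1
  | add e f => e.cost + f.cost + 1
  | sub e f => e.cost + f.cost + 1

end Term

inductive Prog where
  | skip
  | assign (x : ℕ) (e : Term)
  | store (a : ℕ) (e f : Term)
  | emit (e : Term)
  | seq (p q : Prog)
  | ite (e : Term) (p q : Prog)
  | loop (e : Term) (p : Prog)

/-- `Exec p s s' t`: started in state `s`, the program `p` halts in state `s'` after `t` steps.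
A condition counts as true if its value is not zero. -/
inductive Exec : Prog → State → State → ℕ → Prop
  | skip (s : State) : Exec .skip s s 1
  | assign (x : ℕ) (e : Term) (s : State) :
      Exec (.assign x e) s ⟨Function.update s.reg x (e.eval s), s.arr, s.out⟩ (e.cost + 1)
  | store (a : ℕ) (e f : Term) (s : State) :
      Exec (.store a e f) s
        ⟨s.reg, Function.update s.arr a (Function.update (s.arr a) (e.eval s) (f.eval s)), s.out⟩
        (e.cost + f.cost + 1)
  | emit (e : Term) (s : State) :
      Exec (.emit e) s ⟨s.reg, s.arr, s.out ++ [e.eval s]⟩ (e.cost + 1)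
  | seq {p q : Prog} {s s' s'' : State} {t t' : ℕ} :
      Exec p s s' t → Exec q s' s'' t' → Exec (.seq p q) s s'' (t + t')
  | ite_true {e : Term} {p q : Prog} {s s' : State} {t : ℕ} :
      e.eval s ≠ 0 → Exec p s s' t → Exec (.ite e p q) s s' (e.cost + 1 + t)
  | ite_false {e : Term} {p q : Prog} {s s' : State} {t : ℕ} :
      e.eval s = 0 → Exec q s s' t → Exec (.ite e p q) s s' (e.cost + 1 + t)
  | loop_done {e : Term} {p : Prog} {s : State} :
      e.eval s = 0 → Exec (.loop e p) s s (e.cost + 1)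
  | loop_step {e : Term} {p : Prog} {s s' s'' : State} {t t' : ℕ} :
      e.eval s ≠ 0 → Exec p s s' t → Exec (.loop e p) s' s'' t' →
        Exec (.loop e p) s s'' (e.cost + 1 + t + t')

/-- At the start, array `0` holds the input word; all else is zero and the output is empty. -/
def start (w : List ℕ) : State where
  reg _ := 0
  arr a i := if a = 0 then w.getD i 0 else 0
  out := []

end RAM

/-- A single program transforms each formula `φ` into a description of the instance `f φ`, in time
polynomial in the number `n` of variables (a formula has at most `4 n / 3` clauses, so this is the
same as polynomial in the size of `φ`). -/
def ComputableInPolynomialTime (f : ThreeFourSAT → ListEdgeColoringInstance) : Prop :=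
  ∃ (p : RAM.Prog) (T : Polynomial ℕ), ∀ φ : ThreeFourSAT, ∃ (s : RAM.State) (t : ℕ),
    RAM.Exec p (RAM.start φ.word) s t ∧ t ≤ T.eval φ.numVars ∧ (f φ).IsDescribedBy s.out

/-! ### Instances given by labelled edges -/

/-! Let `s` be the least integer with `n ≤ s ^ 2`. The variable `i` has one vertex in each layer,
with index `i / s`, `i % s` or their sum according to the layer modulo 3. Any two of these numbers
determine `i` (`LitTable.eq_of_layerIndex`), and edges join only layers of different residues. Hence
`n` gadgets fit on `O(s)` vertices without sharing an edge.

A gadget is a chain of diamonds. The color of the middle edge of a diamond forces its other four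
edges (`GadgetEdge.diamond_forced`): the path runs through the diamond either straight or with the
two inner layers swapped, and the edges off the path take auxiliary colors. Alternating parity makes
neighboring diamonds agree, so the whole gadget encodes one truth value (`GadgetEdge.exists_pick`).
At the first vertex of diamond `d`, the auxiliary color `2 i + 1 + 2 n (d + 1)` is used if the value
is true, and `2 i + 2 n (d + 1)` otherwise. The color that matches the true literal stays free
there.

A clause is a vertex with three edges, one to such a port for each of its literals. Each list has
the color of the literal at its port and two colors common to the three edges. By pigeonhole, one
edge takes its literal color, so that literal is true; conversely, one true literal suffices
(`Valid.exists_satisfies`, `Valid.isLabelColoring`). Every occurrence of a variable has its own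
diamond, and at most twelve are needed.

Clauses with a common port must use different clause vertices. A port serves at most `s` literals,
so each clause excludes at most `3 s` indices, and a greedy choice among `3 s + 1` succeeds
(`Valid.exists_free`). The program carries out this greedy choice with loop invariants that track
the choice `T` made so far. -/

namespace ListEdgeColoringInstance

/-- The instance on `N` vertices whose edges are indexed by the labels in `Ls`: the edge with label
`l` joins `a l` and `b l` and has the list `L l`. -/
def ofLabels {Λ : Type} (N : ℕ) (Ls : List Λ) (a b : Λ → ℕ) (L : Λ → List ℕ) :
    ListEdgeColoringInstance where
  numVertices := N
  graph := SimpleGraph.fromRel fun u v => ∃ l ∈ Ls, a l = u ∧ b l = v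
  list e := ((Ls.filter fun l => s(a l, b l) = Sym2.map Fin.val e.1).flatMap L).toFinset

/-- The labels describe a simple graph on `N` vertices without repetitions. -/
structure ValidLabels {Λ : Type} (N : ℕ) (Ls : List Λ) (a b : Λ → ℕ) (L : Λ → List ℕ) : Prop where
  left_lt : ∀ l ∈ Ls, a l < N
  right_lt : ∀ l ∈ Ls, b l < N
  ne : ∀ l ∈ Ls, a l ≠ b l
  nodup_colors : ∀ l ∈ Ls, (L l).Nodup
  nodup : Ls.Nodup
  inj : ∀ l ∈ Ls, ∀ k ∈ Ls, s(a l, b l) = s(a k, b k) → l = k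

/-- A list edge coloring, as a function of the labels. -/
def IsLabelColoring {Λ : Type} (Ls : List Λ) (a b : Λ → ℕ) (L : Λ → List ℕ) (col : Λ → ℕ) : Prop :=
  (∀ l ∈ Ls, col l ∈ L l) ∧ ∀ l ∈ Ls, ∀ l' ∈ Ls, l ≠ l' →
    (a l = a l' ∨ a l = b l' ∨ b l = a l' ∨ b l = b l') → col l ≠ col l'

section
variable {Λ : Type} {N : ℕ} {Ls : List Λ} {a b : Λ → ℕ} {L : Λ → List ℕ}

theorem mem_edgeSet_ofLabels (hV : ValidLabels N Ls a b L) (e : Sym2 (Fin N)) :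
    e ∈ (ofLabels N Ls a b L).graph.edgeSet ↔ ∃ l ∈ Ls, Sym2.map Fin.val e = s(a l, b l) := by
  induction e with
  | _ u v =>
    simp only [ofLabels, Sym2.map_mk, Sym2.eq_iff]
    constructor
    · rintro ⟨-, ⟨l, hl, h1, h2⟩ | ⟨l, hl, h1, h2⟩⟩
      · exact ⟨l, hl, Or.inl ⟨h1.symm, h2.symm⟩⟩
      · exact ⟨l, hl, Or.inr ⟨h2.symm, h1.symm⟩⟩
    · rintro ⟨l, hl, h⟩
      have := hV.ne l hl
      refine ⟨fun huv => ?_, ?_⟩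
      · have huv : u = v := huv
        subst huv
        omega
      · rcases h with ⟨h1, h2⟩ | ⟨h1, h2⟩
        · exact Or.inl ⟨l, hl, h1.symm, h2.symm⟩
        · exact Or.inr ⟨l, hl, h2.symm, h1.symm⟩

theorem mem_list_ofLabels (hV : ValidLabels N Ls a b L)
    (e : (ofLabels N Ls a b L).graph.edgeSet) {l : Λ} (hl : l ∈ Ls)
    (h : Sym2.map Fin.val e.1 = s(a l, b l)) :
    (ofLabels N Ls a b L).list e = (L l).toFinset := by
  ext x
  simp only [ofLabels, List.mem_toFinset, List.mem_flatMap, List.mem_filter, decide_eq_true_eq]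
  constructor
  · rintro ⟨l', ⟨hl', h'⟩, hx⟩
    rwa [hV.inj l hl l' hl' (h.symm.trans h'.symm)]
  · exact fun hx => ⟨l, ⟨hl, h.symm⟩, hx⟩

theorem mem_val_map {e : Sym2 (Fin N)} {v : Fin N} {x y : ℕ} (h : Sym2.map Fin.val e = s(x, y)) :
    v ∈ e ↔ (v : ℕ) = x ∨ (v : ℕ) = y := by
  rw [← Sym2.mem_iff, ← h, Sym2.mem_map]
  constructor
  · exact fun hv => ⟨v, hv, rfl⟩
  · rintro ⟨w, hw, hwv⟩
    rwa [← Fin.val_injective hwv]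

theorem isDescribedBy_ofLabels (hV : ValidLabels N Ls a b L) :
    (ofLabels N Ls a b L).IsDescribedBy
      (N :: Ls.flatMap fun l => a l :: b l :: (L l).length :: L l) := by
  have hmem : ∀ e, e ∈ (ofLabels N Ls a b L).graph.edgeSet ↔ ∃ l ∈ Ls, Sym2.map Fin.val e =
      s(a l, b l) := mem_edgeSet_ofLabels hV
  refine ⟨Ls.pmap (fun l h => (⟨a l, h.1⟩, ⟨b l, h.2⟩, L l))
    (fun l hl => (⟨hV.left_lt l hl, hV.right_lt l hl⟩ : a l < N ∧ b l < N)), ?_, ?_, ?_, ?_⟩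
  · congr 1
    simp only [List.flatMap, List.map_pmap]
    rw [List.pmap_eq_map]
  · have hn : (Ls.map fun l => s(a l, b l)).Nodup :=
      hV.nodup.map_on fun l hl l' hl' h => hV.inj l hl l' hl' h
    refine List.Nodup.of_map (Sym2.map Fin.val) ?_
    simp only [List.map_pmap, Sym2.map_mk]
    rwa [List.pmap_eq_map]
  · intro e
    rw [hmem]
    simp only [List.mem_pmap]
    constructor
    · rintro ⟨l, hl, h⟩
      exact ⟨_, ⟨l, hl, rfl⟩, Sym2.map.injective Fin.val_injective (by simpa using h.symm)⟩
    · rintro ⟨_, ⟨l, hl, rfl⟩, rfl⟩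
      exact ⟨l, hl, by simp⟩
  · intro t ht
    obtain ⟨l, hl, rfl⟩ := List.mem_pmap.1 ht
    exact ⟨hV.nodup_colors l hl, fun h => mem_list_ofLabels hV _ hl (by simp)⟩

theorem colorable_ofLabels (hV : ValidLabels N Ls a b L) {col : Λ → ℕ}
    (hc : IsLabelColoring Ls a b L col) : (ofLabels N Ls a b L).Colorable := by
  choose! lab hlab hlab' using fun (e : (ofLabels N Ls a b L).graph.edgeSet) =>
    (mem_edgeSet_ofLabels hV e.1).1 e.2
  refine ⟨fun e => col (lab e), fun e => ?_, ?_⟩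
  · rw [mem_list_ofLabels hV e (hlab e) (hlab' e), List.mem_toFinset]
    exact hc.1 _ (hlab e)
  · rintro e f hef ⟨v, hve, hvf⟩
    refine hc.2 _ (hlab e) _ (hlab f) (fun h => hef ?_) ?_
    · refine Subtype.ext (Sym2.map.injective Fin.val_injective ?_)
      exact (hlab' e).trans ((congrArg (fun l => s(a l, b l)) h).trans (hlab' f).symm)
    · have h1 := (mem_val_map (hlab' e)).1 hve
      have h2 := (mem_val_map (hlab' f)).1 hvf
      omega

theorem exists_isLabelColoring (hV : ValidLabels N Ls a b L)
    {c : (ofLabels N Ls a b L).graph.edgeSet → ℕ} (hc : (ofLabels N Ls a b L).IsColoring c) :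
    ∃ col : Λ → ℕ, IsLabelColoring Ls a b L col ∧
      ∀ e, ∀ l ∈ Ls, Sym2.map Fin.val e.1 = s(a l, b l) → c e = col l := by
  have hex : ∀ l ∈ Ls, ∃ e : (ofLabels N Ls a b L).graph.edgeSet,
      Sym2.map Fin.val e.1 = s(a l, b l) := fun l hl =>
    ⟨⟨s(⟨a l, hV.left_lt l hl⟩, ⟨b l, hV.right_lt l hl⟩),
      (mem_edgeSet_ofLabels hV _).2 ⟨l, hl, rfl⟩⟩, rfl⟩
  classical
  let ed : ∀ l ∈ Ls, (ofLabels N Ls a b L).graph.edgeSet := fun l hl => (hex l hl).choose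
  have hed : ∀ l hl, Sym2.map Fin.val (ed l hl).1 = s(a l, b l) := fun l hl =>
    (hex l hl).choose_spec
  refine ⟨fun l => if h : l ∈ Ls then c (ed l h) else 0, ⟨fun l hl => ?_, ?_⟩, ?_⟩
  · simp only [hl, dif_pos]
    rw [← List.mem_toFinset, ← mem_list_ofLabels hV (ed l hl) hl (hed l hl)]
    exact hc.1 _
  · intro l hl l' hl' hne hsh
    simp only [hl, hl', dif_pos]
    refine hc.2 _ _ (fun h => hne (hV.inj l hl l' hl' ?_)) ?_
    · rw [← hed l hl, ← hed l' hl', h]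
    · have h1 := fun v => @mem_val_map N (ed l hl).1 v _ _ (hed l hl)
      have h2 := fun v => @mem_val_map N (ed l' hl').1 v _ _ (hed l' hl')
      by_cases h : a l = a l' ∨ a l = b l'
      · exact ⟨⟨a l, hV.left_lt l hl⟩, (h1 _).2 (Or.inl rfl), (h2 _).2 h⟩
      · exact ⟨⟨b l, hV.right_lt l hl⟩, (h1 _).2 (Or.inr rfl), (h2 _).2 (by simpa using by tauto)⟩
  · intro e l hl he
    simp only [hl, dif_pos]
    congr 1
    exact Subtype.ext (Sym2.map.injective Fin.val_injective (he.trans (hed l hl).symm))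

end

end ListEdgeColoringInstance

/-- A sequence of vertices, each adjacent to the next one, forms a walk. -/
theorem SimpleGraph.exists_walk_of_seq {V : Type*} (G : SimpleGraph V) (w : ℕ → V) (m : ℕ)
    (h : ∀ k < m, G.Adj (w k) (w (k + 1))) :
    ∃ P : G.Walk (w 0) (w m), P.support = (List.range (m + 1)).map w ∧
      P.edges = (List.range m).map fun k => s(w k, w (k + 1)) := by
  induction m with
  | zero => exact ⟨.nil, by simp, by simp⟩
  | succ m ih =>
    obtain ⟨P, h1, h2⟩ := ih fun k hk => h k (by omega)
    refine ⟨P.concat (h m (by omega)), ?_, ?_⟩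
    · rw [SimpleGraph.Walk.support_concat, h1, List.range_succ (n := m + 1)]
      simp
    · rw [SimpleGraph.Walk.edges_concat, h2, List.range_succ (n := m)]
      simp

/-! ### The path gadget of a variable

The gadget of a variable has one vertex in each of the 63 layers. For `d < 20`, the vertices in the
layers `3 d, …, 3 d + 3` carry five of the six possible edges. In a list edge coloring the edges in
the two colors of the variable form a path that visits the layers in increasing order if the variable
is true, and with the layers `3 d + 1` and `3 d + 2` interchanged otherwise. -/

/-- A type of edges of the path gadgets: for the variable `i`, the edge joins the layers `lo` and
`hi` and has the list `{2 i + b, 2 i + aux + 2 n e}`. -/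
structure GadgetEdge where
  lo : ℕ
  hi : ℕ
  b : ℕ
  aux : ℕ
  e : ℕ
deriving DecidableEq

namespace GadgetEdge

/-- In this order the edges are called A, M, Z, U, W below. The pair of layers `3 d`, `3 d + 3` is
left out because their residues modulo 3 agree. A and W meet in layer `3 d + 1` and share an
auxiliary color; Z and U meet in layer `3 d + 2` and share the other one. -/
def diamond (d : ℕ) : List GadgetEdge :=
  [⟨3 * d, 3 * d + 1, d % 2, 0, d + 1⟩, ⟨3 * d + 1, 3 * d + 2, 0, 1, 0⟩,
    ⟨3 * d + 2, 3 * d + 3, d % 2, 1, d + 1⟩, ⟨3 * d, 3 * d + 2, 1 - d % 2, 1, d + 1⟩,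
    ⟨3 * d + 1, 3 * d + 3, 1 - d % 2, 0, d + 1⟩]

/-- Only the first twelve diamonds (four occurrences times three positions) serve as ports. The
other diamonds and the two final edges prolong the path to 63 layers. -/
def all : List GadgetEdge :=
  (List.range 20).flatMap diamond ++ [⟨60, 61, 0, 1, 0⟩, ⟨61, 62, 0, 1, 0⟩]

/-- If the value of the variable `i` is `f` and `pick f τ = (b, e)`, then the edge has the color
`2 i + b + 2 n e`. -/
def pick (f : Bool) (τ : GadgetEdge) : ℕ × ℕ :=
  if τ.e = 0 then ((τ.lo + if f then 0 else 1) % 2, 0)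
  else if decide (τ.hi = τ.lo + 1) = f then (τ.b, 0) else (τ.aux, τ.e)

/-- The layers in the order in which the path visits them. -/
def visit (f : Bool) (k : ℕ) : ℕ :=
  if f = true ∨ 60 ≤ k then k else if k % 3 = 1 then k + 1 else if k % 3 = 2 then k - 1 else k

/-- The two types of edges have a layer in common. -/
def Meets (τ τ' : GadgetEdge) : Prop :=
  τ.lo = τ'.lo ∨ τ.lo = τ'.hi ∨ τ.hi = τ'.lo ∨ τ.hi = τ'.hi

instance (τ τ' : GadgetEdge) : Decidable (Meets τ τ') := by
  unfold Meets; infer_instance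

/-- The edge joins the two given layers. -/
def Joins (τ : GadgetEdge) (k l : ℕ) : Prop :=
  (τ.lo = k ∧ τ.hi = l) ∨ (τ.lo = l ∧ τ.hi = k)

instance (τ : GadgetEdge) (k l : ℕ) : Decidable (Joins τ k l) := by
  unfold Joins; infer_instance

theorem bounds : ∀ τ ∈ all, τ.lo < τ.hi ∧ τ.hi < 63 ∧ τ.lo % 3 ≠ τ.hi % 3 ∧ τ.b < 2 ∧ τ.aux < 2 ∧
    τ.e ≤ 20 ∧ (τ.e = 0 → τ.b ≠ τ.aux) := by
  decide +kernel

theorem nodup_map_all : (all.map fun τ => 63 * τ.lo + τ.hi).Nodup := by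
  decide +kernel

theorem nodup_all : all.Nodup :=
  List.Nodup.of_map _ nodup_map_all

theorem eq_of_lo_hi {τ τ' : GadgetEdge} (h : τ ∈ all) (h' : τ' ∈ all) (hlo : τ.lo = τ'.lo)
    (hhi : τ.hi = τ'.hi) : τ = τ' :=
  List.inj_on_of_nodup_map nodup_map_all h h' (by simp only [hlo, hhi])

/-- A finite check over all pairs of the 102 types, kept Boolean so that it evaluates directly. -/
theorem pick_ne_check (f : Bool) : (all.all fun τ => all.all fun τ' =>
    !(Nat.beq τ.lo τ'.lo || Nat.beq τ.lo τ'.hi || Nat.beq τ.hi τ'.lo || Nat.beq τ.hi τ'.hi) ||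
    (Nat.beq τ.lo τ'.lo && Nat.beq τ.hi τ'.hi) ||
    !(Nat.beq (pick f τ).1 (pick f τ').1 && Nat.beq (pick f τ).2 (pick f τ').2)) = true := by
  revert f
  decide +kernel

theorem pick_ne (f : Bool) {τ τ' : GadgetEdge} (h : τ ∈ all) (h' : τ' ∈ all) (hm : Meets τ τ')
    (hne : τ ≠ τ') : pick f τ ≠ pick f τ' := by
  intro hp
  have := List.all_eq_true.1 (List.all_eq_true.1 (pick_ne_check f) τ h) τ' h'
  simp only [hp, Nat.beq_refl, Bool.and_self, Bool.not_true, Bool.or_false, Bool.or_eq_true,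
    Bool.not_eq_true', Bool.or_eq_false_iff, Bool.and_eq_true, Nat.beq_eq] at this
  have hb : ∀ {x y : ℕ}, x.beq y = false → x ≠ y := fun h => Nat.ne_of_beq_eq_false h
  rcases this with ⟨⟨⟨h1, h2⟩, h3⟩, h4⟩ | ⟨h1, h2⟩
  · rcases hm with h | h | h | h
    · exact hb h1 h
    · exact hb h2 h
    · exact hb h3 h
    · exact hb h4 h
  · exact hne (eq_of_lo_hi h h' h1 h2)

theorem pick_mem : ∀ f : Bool, ∀ τ ∈ all, pick f τ = (τ.b, 0) ∨ pick f τ = (τ.aux, τ.e) := by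
  decide +kernel

/-- In layer `3 d` the auxiliary color of diamond `d` sits on U if the value is true and on A
otherwise; the edges arriving from diamond `d - 1` have `e = d`. So the gadget blocks only the color
of the false literal. -/
theorem pick_fst_of_port : ∀ f : Bool, ∀ τ ∈ all, ∀ d < 12, (pick f τ).2 = d + 1 →
    (τ.lo = 3 * d ∨ τ.hi = 3 * d) → (pick f τ).1 = if f then 1 else 0 := by
  decide +kernel

theorem exists_pick_of_port : ∀ f : Bool, ∀ d < 12, ∃ τ ∈ all, τ.lo = 3 * d ∧
    pick f τ = (if f then 1 else 0, d + 1) := by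
  decide +kernel

/-- With `exists_visit_joins`: the edges in the two colors of the variable are exactly the
consecutive pairs of the visiting order. -/
theorem exists_joins_visit : ∀ f : Bool, ∀ k < 62, ∃ τ ∈ all, (pick f τ).2 = 0 ∧
    τ.Joins (visit f k) (visit f (k + 1)) := by
  decide +kernel

theorem exists_visit_joins : ∀ f : Bool, ∀ τ ∈ all, (pick f τ).2 = 0 → ∃ k < 62,
    τ.Joins (visit f k) (visit f (k + 1)) := by
  decide +kernel

theorem visit_lt (f : Bool) {k : ℕ} (hk : k < 63) : visit f k < 63 := by
  unfold visit; split_ifs <;> omega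

theorem visit_visit (f : Bool) {k : ℕ} : visit f (visit f k) = k := by
  cases f
  · simp only [visit, Bool.false_eq_true, false_or]
    split_ifs <;> omega
  · simp [visit]

theorem diamond_subset {d : ℕ} (hd : d < 20) {τ : GadgetEdge} (h : τ ∈ diamond d) : τ ∈ all :=
  List.mem_append_left _ (List.mem_flatMap.2 ⟨d, List.mem_range.2 hd, h⟩)

/-- The middle edge M meets all four others. Its color drives two of them to their auxiliary colors,
and these in turn, shared by A, W and by Z, U, drive the remaining two to their main colors. -/
theorem diamond_forced {P N A A' cA cM cZ cU cW : ℕ} (hA : cA = P ∨ cA = A)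
    (hZ : cZ = P ∨ cZ = A') (hU : cU = N ∨ cU = A') (hW : cW = N ∨ cW = A) (hMA : cM ≠ cA)
    (hMZ : cM ≠ cZ) (hMU : cM ≠ cU) (hMW : cM ≠ cW) (hAW : cA ≠ cW) (hZU : cZ ≠ cU) :
    (cM = N → cA = P ∧ cZ = P ∧ cU = A' ∧ cW = A) ∧
      (cM = P → cA = A ∧ cZ = A' ∧ cU = N ∧ cW = N) := by
  grind

/-- The coloring of a path gadget is determined by the value of the variable. -/
theorem exists_pick {n i : ℕ} {col : GadgetEdge → ℕ}
    (hmem : ∀ τ ∈ all, col τ = 2 * i + τ.b ∨ col τ = 2 * i + τ.aux + 2 * n * τ.e)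
    (hne : ∀ τ ∈ all, ∀ τ' ∈ all, τ ≠ τ' → Meets τ τ' → col τ ≠ col τ') :
    ∃ f : Bool, ∀ τ ∈ all, col τ = 2 * i + (pick f τ).1 + 2 * n * (pick f τ).2 := by
  have hdia : ∀ d < 20, ∀ f : Bool,
      (col ⟨3 * d + 1, 3 * d + 2, 0, 1, 0⟩ = 2 * i + (3 * d + 1 + if f then 0 else 1) % 2) →
      ∀ τ ∈ diamond d, col τ = 2 * i + (pick f τ).1 + 2 * n * (pick f τ).2 := by
    intro d hd f hf
    have m : ∀ τ ∈ diamond d, τ ∈ all := fun τ h => diamond_subset hd h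
    have hA := hmem ⟨3 * d, 3 * d + 1, d % 2, 0, d + 1⟩ (m _ (by simp [diamond]))
    have hZ := hmem ⟨3 * d + 2, 3 * d + 3, d % 2, 1, d + 1⟩ (m _ (by simp [diamond]))
    have hU := hmem ⟨3 * d, 3 * d + 2, 1 - d % 2, 1, d + 1⟩ (m _ (by simp [diamond]))
    have hW := hmem ⟨3 * d + 1, 3 * d + 3, 1 - d % 2, 0, d + 1⟩ (m _ (by simp [diamond]))
    have hMA := hne ⟨3 * d + 1, 3 * d + 2, 0, 1, 0⟩ (m _ (by simp [diamond]))
      ⟨3 * d, 3 * d + 1, d % 2, 0, d + 1⟩ (m _ (by simp [diamond])) (by simp) (by simp [Meets])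
    have hMZ := hne ⟨3 * d + 1, 3 * d + 2, 0, 1, 0⟩ (m _ (by simp [diamond]))
      ⟨3 * d + 2, 3 * d + 3, d % 2, 1, d + 1⟩ (m _ (by simp [diamond])) (by simp) (by simp [Meets])
    have hMU := hne ⟨3 * d + 1, 3 * d + 2, 0, 1, 0⟩ (m _ (by simp [diamond]))
      ⟨3 * d, 3 * d + 2, 1 - d % 2, 1, d + 1⟩ (m _ (by simp [diamond])) (by simp) (by simp [Meets])
    have hMW := hne ⟨3 * d + 1, 3 * d + 2, 0, 1, 0⟩ (m _ (by simp [diamond]))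
      ⟨3 * d + 1, 3 * d + 3, 1 - d % 2, 0, d + 1⟩ (m _ (by simp [diamond])) (by simp)
      (by simp [Meets])
    have hAW := hne ⟨3 * d, 3 * d + 1, d % 2, 0, d + 1⟩ (m _ (by simp [diamond]))
      ⟨3 * d + 1, 3 * d + 3, 1 - d % 2, 0, d + 1⟩ (m _ (by simp [diamond])) (by simp)
      (by simp [Meets])
    have hZU := hne ⟨3 * d + 2, 3 * d + 3, d % 2, 1, d + 1⟩ (m _ (by simp [diamond]))
      ⟨3 * d, 3 * d + 2, 1 - d % 2, 1, d + 1⟩ (m _ (by simp [diamond])) (by simp) (by simp [Meets])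
    simp only at hA hZ hU hW
    obtain ⟨hN, hP⟩ := diamond_forced hA hZ hU hW hMA hMZ hMU hMW hAW hZU
    intro τ hτ
    simp only [diamond, List.mem_cons, List.not_mem_nil, or_false] at hτ
    cases f
    · obtain ⟨kA, kZ, kU, kW⟩ := hP (by rw [hf]; simp; omega)
      rcases hτ with rfl | rfl | rfl | rfl | rfl
      · simpa [pick] using kA
      · simpa [pick] using hf
      · simpa [pick] using kZ
      · simpa [pick] using kU
      · simpa [pick] using kW
    · obtain ⟨kA, kZ, kU, kW⟩ := hN (by rw [hf]; simp; omega)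
      rcases hτ with rfl | rfl | rfl | rfl | rfl
      · simpa [pick] using kA
      · simpa [pick] using hf
      · simpa [pick] using kZ
      · simpa [pick] using kU
      · simpa [pick] using kW
  have hmid : ∃ f : Bool, ∀ d < 20, col ⟨3 * d + 1, 3 * d + 2, 0, 1, 0⟩ =
      2 * i + (3 * d + 1 + if f then 0 else 1) % 2 := by
    have hM : ∀ d < 20, col ⟨3 * d + 1, 3 * d + 2, 0, 1, 0⟩ = 2 * i ∨
        col ⟨3 * d + 1, 3 * d + 2, 0, 1, 0⟩ = 2 * i + 1 := fun d hd => by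
      simpa using hmem ⟨3 * d + 1, 3 * d + 2, 0, 1, 0⟩ (diamond_subset hd (by simp [diamond]))
    -- The truth value is read off the middle edge of diamond `0`, which has color `2 i + 1` on the
    -- straight path.
    refine ⟨decide (col ⟨1, 2, 0, 1, 0⟩ = 2 * i + 1), fun d hd => ?_⟩
    generalize hf : decide (col ⟨1, 2, 0, 1, 0⟩ = 2 * i + 1) = f
    induction d with
    | zero =>
      have := hM 0 hd
      cases f <;> simp at hf ⊢ <;> simp_all
    | succ d ih =>
      have ih' := hdia d (by omega) f (ih (by omega))
      have h1 := hM (d + 1) hd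
      have h2 := hdia (d + 1) hd (!f)
      have hZ := ih' ⟨3 * d + 2, 3 * d + 3, d % 2, 1, d + 1⟩ (by simp [diamond])
      have hW := ih' ⟨3 * d + 1, 3 * d + 3, 1 - d % 2, 0, d + 1⟩ (by simp [diamond])
      have hZU := hne ⟨3 * d + 2, 3 * d + 3, d % 2, 1, d + 1⟩
        (diamond_subset (d := d) (by omega) (by simp [diamond]))
        ⟨3 * (d + 1), 3 * (d + 1) + 2, 1 - (d + 1) % 2, 1, d + 1 + 1⟩
        (diamond_subset hd (by simp [diamond])) (by simp) (by simp [Meets]; omega)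
      have hWA := hne ⟨3 * d + 1, 3 * d + 3, 1 - d % 2, 0, d + 1⟩
        (diamond_subset (d := d) (by omega) (by simp [diamond]))
        ⟨3 * (d + 1), 3 * (d + 1) + 1, (d + 1) % 2, 0, d + 1 + 1⟩
        (diamond_subset hd (by simp [diamond])) (by simp) (by simp [Meets]; omega)
      -- If diamond `d + 1` had the opposite value, two edges of equal color would meet in layer `3
      -- d + 3`: Z and the next U if `f` is true, W and the next A otherwise.
      by_contra hcon
      have h3 := h2 (by cases f <;> simp at hcon ⊢ <;> omega)
      have hA := h3 ⟨3 * (d + 1), 3 * (d + 1) + 1, (d + 1) % 2, 0, d + 1 + 1⟩ (by simp [diamond])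
      have hU := h3 ⟨3 * (d + 1), 3 * (d + 1) + 2, 1 - (d + 1) % 2, 1, d + 1 + 1⟩
        (by simp [diamond])
      cases f <;> simp [pick] at hA hU hZ hW <;> omega
  obtain ⟨f, hf⟩ := hmid
  refine ⟨f, fun τ hτ => ?_⟩
  have h19 := hdia 19 (by omega) f (hf 19 (by omega))
  have hZ := h19 ⟨59, 60, 1, 1, 20⟩ (by simp [diamond])
  have hW := h19 ⟨58, 60, 0, 0, 20⟩ (by simp [diamond])
  have h60 := hmem ⟨60, 61, 0, 1, 0⟩ (by simp [all])
  have h61 := hmem ⟨61, 62, 0, 1, 0⟩ (by simp [all])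
  have n1 := hne ⟨59, 60, 1, 1, 20⟩ (by decide +kernel) ⟨60, 61, 0, 1, 0⟩ (by simp [all]) (by simp)
    (by simp [Meets])
  have n2 := hne ⟨58, 60, 0, 0, 20⟩ (by decide +kernel) ⟨60, 61, 0, 1, 0⟩ (by simp [all]) (by simp)
    (by simp [Meets])
  have n3 := hne ⟨60, 61, 0, 1, 0⟩ (by simp [all]) ⟨61, 62, 0, 1, 0⟩ (by simp [all]) (by simp)
    (by simp [Meets])
  rcases List.mem_append.1 hτ with h | h
  · obtain ⟨d, hd, hτd⟩ := List.mem_flatMap.1 h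
    rw [List.mem_range] at hd
    exact hdia d hd f (hf d hd) τ hτd
  · simp only [List.mem_cons, List.not_mem_nil, or_false] at h
    rcases h with rfl | rfl <;> cases f <;> simp [pick] at hZ hW h60 h61 ⊢ <;> omega

end GadgetEdge

/-! ### The instance of a formula -/

/-- A formula with `n` variables and `m` clauses, given by the codes of its literals. -/
structure LitTable where
  n : ℕ
  m : ℕ
  lit : ℕ → ℕ → ℕ

theorem exists_le_sq (n : ℕ) : ∃ s, n ≤ s * s := ⟨n, Nat.le_mul_self n⟩

/-- The least `s` with `n ≤ s ^ 2`. -/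
def side (n : ℕ) : ℕ := Nat.find (exists_le_sq n)

theorem le_side_mul_side (n : ℕ) : n ≤ side n * side n := Nat.find_spec (exists_le_sq n)

theorem lt_of_lt_side {n k : ℕ} (h : k < side n) : k * k < n :=
  not_le.1 (Nat.find_min (exists_le_sq n) h)

theorem side_le (n : ℕ) : side n ≤ n := Nat.find_min' _ (Nat.le_mul_self n)

/-- The index, within its layer, of the vertex of the variable `i` in the layer `k`. -/
def layerIndex (s i k : ℕ) : ℕ :=
  if k % 3 = 0 then i / s else if k % 3 = 1 then i % s else i / s + i % s

namespace LitTable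

def var (F : LitTable) (c j : ℕ) : ℕ := F.lit c j / 2

open Classical in
/-- The number of clauses before the clause `c` that contain the variable `x`. -/
noncomputable def occ (F : LitTable) (c x : ℕ) : ℕ :=
  ((Finset.range c).filter fun c' => ∃ j < 3, F.var c' j = x).card

/-- The number of the diamond that is used by the literal `j` of the clause `c`. -/
noncomputable def slotIndex (F : LitTable) (c j : ℕ) : ℕ := 3 * F.occ c (F.var c j) + j

/-- The vertex at which the literal `j` of the clause `c` is tested. -/
noncomputable def port (F : LitTable) (c j : ℕ) : ℕ :=
  63 * (F.var c j / side F.n) + 3 * F.slotIndex c j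

structure Valid (F : LitTable) : Prop where
  lit_lt : ∀ c < F.m, ∀ j < 3, F.lit c j < 2 * F.n
  var_inj : ∀ c < F.m, ∀ j < 3, ∀ j' < 3, F.var c j = F.var c j' → j = j'
  occ_le : ∀ x < F.n, F.occ F.m x ≤ 4

/-- `T c` is the index of the vertex of the clause `c`; the edges of the first `k` clauses are
different from each other. -/
def SlotsGood (F : LitTable) (T : ℕ → ℕ) (k : ℕ) : Prop :=
  ∀ c < k, T c ≤ 3 * side F.n ∧ ∀ d < k, c ≠ d → ∀ j < 3, ∀ j' < 3,
    F.port c j = F.port d j' → T c ≠ T d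

/-- `inl (i, τ)` is an edge in the gadget of the variable `i`, and `inr (c, j)` is the edge for the
literal `j` of the clause `c`. -/
abbrev Label : Type := (ℕ × GadgetEdge) ⊕ (ℕ × ℕ)

def labels (F : LitTable) : List Label :=
  (List.range F.n ×ˢ GadgetEdge.all).map Sum.inl ++ (List.range F.m ×ˢ List.range 3).map Sum.inr

noncomputable def left (F : LitTable) : Label → ℕ
  | .inl (i, τ) => 63 * layerIndex (side F.n) i τ.lo + τ.lo
  | .inr (c, j) => F.port c j

def right (F : LitTable) (T : ℕ → ℕ) : Label → ℕ
  | .inl (i, τ) => 63 * layerIndex (side F.n) i τ.hi + τ.hi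
  | .inr (c, _) => 63 * (2 * side F.n + T c) + 1

noncomputable def colors (F : LitTable) : Label → List ℕ
  | .inl (i, τ) => [2 * i + τ.b, 2 * i + τ.aux + 2 * F.n * τ.e]
  | .inr (c, j) => [F.lit c j + 2 * F.n * (F.slotIndex c j + 1), 42 * F.n + 2 * c,
      42 * F.n + 2 * c + 1]

def Satisfies (F : LitTable) (f : ℕ → Bool) : Prop :=
  ∀ c < F.m, ∃ j < 3, f (F.var c j) = decide (F.lit c j % 2 = 0)

section
variable {F : LitTable}

theorem mem_labels_inl {i : ℕ} {τ : GadgetEdge} :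
    (Sum.inl (i, τ) : Label) ∈ F.labels ↔ i < F.n ∧ τ ∈ GadgetEdge.all := by
  simp [labels]

theorem mem_labels_inr {c j : ℕ} : (Sum.inr (c, j) : Label) ∈ F.labels ↔ c < F.m ∧ j < 3 := by
  simp [labels]

theorem nodup_labels : F.labels.Nodup := by
  refine List.Nodup.append ?_ ?_ ?_
  · exact (List.Nodup.product List.nodup_range GadgetEdge.nodup_all).map Sum.inl_injective
  · exact (List.Nodup.product List.nodup_range List.nodup_range).map Sum.inr_injective
  · intro x h h'
    simp only [List.mem_map] at h h'
    obtain ⟨_, _, rfl⟩ := h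
    obtain ⟨_, _, h⟩ := h'
    cases h

open Classical in
theorem occ_succ (c x : ℕ) :
    F.occ (c + 1) x = F.occ c x + if ∃ j < 3, F.var c j = x then 1 else 0 := by
  unfold occ
  rw [Finset.range_add_one, Finset.filter_insert]
  split_ifs
  · rw [Finset.card_insert_of_notMem (by simp)]
  · simp

theorem occ_mono (x : ℕ) : Monotone fun c => F.occ c x :=
  monotone_nat_of_le_succ fun c => by rw [occ_succ]; omega

theorem occ_lt_occ {c c' x j : ℕ} (hc : c < c') (hj : j < 3) (h : F.var c j = x) :
    F.occ c x < F.occ c' x := by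
  have h1 : F.occ (c + 1) x ≤ F.occ c' x := F.occ_mono x (by omega)
  rw [occ_succ, if_pos ⟨j, hj, h⟩] at h1
  omega

theorem Valid.var_lt (hF : F.Valid) {c j : ℕ} (hc : c < F.m) (hj : j < 3) : F.var c j < F.n := by
  have := hF.lit_lt c hc j hj
  unfold var
  omega

theorem Valid.occ_lt (hF : F.Valid) {c j : ℕ} (hc : c < F.m) (hj : j < 3) :
    F.occ c (F.var c j) < 4 :=
  (occ_lt_occ hc hj rfl).trans_le (hF.occ_le _ (hF.var_lt hc hj))

theorem Valid.slotIndex_lt (hF : F.Valid) {c j : ℕ} (hc : c < F.m) (hj : j < 3) :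
    F.slotIndex c j < 12 := by
  have := hF.occ_lt hc hj
  unfold slotIndex
  omega

/-- A diamond of a variable is used by one literal only. -/
theorem eq_of_var_of_slotIndex {c c' j j' : ℕ} (hj : j < 3) (hj' : j' < 3)
    (hv : F.var c j = F.var c' j') (hs : F.slotIndex c j = F.slotIndex c' j') :
    c = c' ∧ j = j' := by
  unfold slotIndex at hs
  have h1 : F.occ c (F.var c j) = F.occ c' (F.var c' j') := by omega
  rw [← hv] at h1
  refine ⟨?_, by omega⟩
  rcases lt_trichotomy c c' with h | h | h
  · have := occ_lt_occ (F := F) h hj rfl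
    omega
  · exact h
  · have := occ_lt_occ h hj' hv.symm
    omega

theorem Valid.div_side_lt (_hF : F.Valid) {i : ℕ} (hi : i < F.n) : i / side F.n < side F.n :=
  Nat.div_lt_of_lt_mul (hi.trans_le (le_side_mul_side _))

theorem side_pos {n i : ℕ} (hi : i < n) : 0 < side n := by
  have := le_side_mul_side n
  rcases Nat.eq_zero_or_pos (side n) with h | h
  · rw [h] at this
    omega
  · exact h

theorem layerIndex_lt {n i : ℕ} (hi : i < n) (k : ℕ) : layerIndex (side n) i k < 2 * side n := by
  have h1 : i / side n < side n := Nat.div_lt_of_lt_mul (hi.trans_le (le_side_mul_side _))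
  have h2 : i % side n < side n := Nat.mod_lt _ (side_pos hi)
  unfold layerIndex
  split_ifs <;> omega

/-- Any two of the quotient, the remainder and their sum give the third, hence `i`. -/
theorem eq_of_layerIndex {s i i' k l : ℕ} (hkl : k % 3 ≠ l % 3)
    (h : layerIndex s i k = layerIndex s i' k) (h' : layerIndex s i l = layerIndex s i' l) :
    i = i' := by
  have h3 : i / s = i' / s ∧ i % s = i' % s := by
    unfold layerIndex at h h'
    split_ifs at h h' <;> omega
  rw [← Nat.div_add_mod i s, ← Nat.div_add_mod i' s, h3.1, h3.2]

theorem Valid.port_lt (hF : F.Valid) {c j : ℕ} (hc : c < F.m) (hj : j < 3) :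
    F.port c j < 63 * side F.n := by
  have h1 := hF.div_side_lt (hF.var_lt hc hj)
  have h2 := hF.slotIndex_lt hc hj
  unfold port
  omega

/-- The layer `3 * slotIndex` is less than 36, so a port determines its layer and its index within
the layer. -/
theorem Valid.eq_of_port (hF : F.Valid) {c c' j j' : ℕ} (hc : c < F.m) (hc' : c' < F.m)
    (hj : j < 3) (hj' : j' < 3) (h : F.port c j = F.port c' j') :
    F.var c j / side F.n = F.var c' j' / side F.n ∧ F.slotIndex c j = F.slotIndex c' j' := by
  have h1 := hF.slotIndex_lt hc hj
  have h2 := hF.slotIndex_lt hc' hj'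
  unfold port at h
  omega

open ListEdgeColoringInstance

/-- Here `378 = 63 * 6`: gadget vertices have index below `2 s`, clause vertices have index from `2
s` to `5 s`. Clause vertices lie in layer `1`, which contains no port. Two edges of one clause
differ because their slots have different residues modulo 3; edges of different clauses differ by
`SlotsGood`. -/
theorem Valid.validLabels (hF : F.Valid) {T : ℕ → ℕ} (hT : F.SlotsGood T F.m) :
    ValidLabels (378 * side F.n) F.labels F.left (F.right T) F.colors where
  left_lt := by
    rintro (⟨i, τ⟩ | ⟨c, j⟩) h
    · rw [mem_labels_inl] at h
      have h1 := layerIndex_lt h.1 τ.lo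
      have h2 := GadgetEdge.bounds τ h.2
      simp only [left]
      omega
    · rw [mem_labels_inr] at h
      have := hF.port_lt h.1 h.2
      simp only [left]
      omega
  right_lt := by
    rintro (⟨i, τ⟩ | ⟨c, j⟩) h
    · rw [mem_labels_inl] at h
      have h1 := layerIndex_lt h.1 τ.hi
      have h2 := GadgetEdge.bounds τ h.2
      simp only [right]
      omega
    · rw [mem_labels_inr] at h
      have h1 := (hT c h.1).1
      have h2 := side_pos (hF.var_lt h.1 h.2)
      simp only [right]
      omega
  ne := by
    rintro (⟨i, τ⟩ | ⟨c, j⟩) h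
    · rw [mem_labels_inl] at h
      have h2 := GadgetEdge.bounds τ h.2
      simp only [left, right]
      omega
    · rw [mem_labels_inr] at h
      have := hF.port_lt h.1 h.2
      simp only [left, right]
      omega
  nodup_colors := by
    rintro (⟨i, τ⟩ | ⟨c, j⟩) h
    · rw [mem_labels_inl] at h
      have h2 := GadgetEdge.bounds τ h.2
      simp only [colors, List.nodup_cons, List.mem_singleton, List.not_mem_nil, not_false_eq_true,
        List.nodup_nil, and_true]
      rcases Nat.eq_zero_or_pos τ.e with he | he
      · have := h2.2.2.2.2.2.2 he
        rw [he]
        omega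
      · have : F.n ≤ F.n * τ.e := Nat.le_mul_of_pos_right _ he
        rw [mul_assoc]
        omega
    · rw [mem_labels_inr] at h
      have h1 := hF.lit_lt c h.1 j h.2
      have h2 := hF.slotIndex_lt h.1 h.2
      have h3 : F.n * (F.slotIndex c j + 1) ≤ F.n * 12 := Nat.mul_le_mul_left _ (by omega)
      simp only [colors, List.nodup_cons, List.not_mem_nil, not_false_eq_true,
        List.nodup_nil, and_true, List.mem_cons, or_false]
      rw [mul_assoc]
      omega
  nodup := nodup_labels
  inj := by
    rintro (⟨i, τ⟩ | ⟨c, j⟩) h (⟨i', τ'⟩ | ⟨c', j'⟩) h' heq <;>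
      simp only [mem_labels_inl, mem_labels_inr] at h h' <;>
      simp only [left, right, Sym2.eq_iff] at heq
    · have h1 := GadgetEdge.bounds τ h.2
      have h2 := GadgetEdge.bounds τ' h'.2
      have hlo : τ.lo = τ'.lo := by omega
      have hhi : τ.hi = τ'.hi := by omega
      obtain rfl := GadgetEdge.eq_of_lo_hi h.2 h'.2 hlo hhi
      rw [eq_of_layerIndex (s := side F.n) (i := i) (i' := i') h1.2.2.1 (by omega) (by omega)]
    · have h1 := GadgetEdge.bounds τ h.2
      have h2 := layerIndex_lt h.1 τ.lo
      have h3 := layerIndex_lt h.1 τ.hi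
      omega
    · have h1 := GadgetEdge.bounds τ' h'.2
      have h2 := layerIndex_lt h'.1 τ'.lo
      have h3 := layerIndex_lt h'.1 τ'.hi
      omega
    · have h1 := hF.port_lt h.1 h.2
      have h2 := hF.port_lt h'.1 h'.2
      have h3 : F.port c j = F.port c' j' := by omega
      have h4 : T c = T c' := by omega
      have hcc : c = c' := by
        by_contra hne
        exact (hT c h.1).2 c' h'.1 hne j h.2 j' h'.2 h3 h4
      subst hcc
      have h5 := (hF.eq_of_port h.1 h'.1 h.2 h'.2 h3).2
      unfold slotIndex at h5
      have : j = j' := by omega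
      rw [this]

/-! ### Colorings and satisfying assignments -/

theorem eq_of_add_mul_eq {M y y' E E' : ℕ} (hy : y < M) (hy' : y' < M)
    (h : y + M * E = y' + M * E') : y = y' ∧ E = E' := by
  have h1 : (y + M * E) % M = (y' + M * E') % M := by rw [h]
  have h2 : (y + M * E) / M = (y' + M * E') / M := by rw [h]
  rw [Nat.add_mul_mod_self_left, Nat.add_mul_mod_self_left, Nat.mod_eq_of_lt hy,
    Nat.mod_eq_of_lt hy'] at h1
  rw [Nat.add_mul_div_left _ _ (by omega), Nat.add_mul_div_left _ _ (by omega),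
    Nat.div_eq_of_lt hy, Nat.div_eq_of_lt hy'] at h2
  omega

/-- The coloring that belongs to an assignment `f`, where the literal `g c` of the clause `c` is
true. -/
noncomputable def labelColor (F : LitTable) (f : ℕ → Bool) (g : ℕ → ℕ) : Label → ℕ
  | .inl (i, τ) => 2 * i + (GadgetEdge.pick (f i) τ).1 + 2 * F.n * (GadgetEdge.pick (f i) τ).2
  | .inr (c, j) => if j = g c then F.lit c j + 2 * F.n * (F.slotIndex c j + 1)
      else 42 * F.n + 2 * c + if (j + 1) % 3 = g c then 1 else 0

theorem pick_bounds (f : Bool) {τ : GadgetEdge} (h : τ ∈ GadgetEdge.all) :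
    (GadgetEdge.pick f τ).1 < 2 ∧ (GadgetEdge.pick f τ).2 ≤ 20 := by
  have h1 := GadgetEdge.bounds τ h
  rcases GadgetEdge.pick_mem f τ h with h2 | h2 <;> rw [h2] <;> simp <;> omega

/-- Since `e ≤ 20`, gadget colors stay below `2 n + 20 * 2 n`; this is why the private colors of the
clauses start at `42 n`. -/
theorem labelColor_inl_lt (f : ℕ → Bool) (g : ℕ → ℕ) {i : ℕ} {τ : GadgetEdge} (hi : i < F.n)
    (hτ : τ ∈ GadgetEdge.all) : F.labelColor f g (.inl (i, τ)) < 42 * F.n := by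
  have h1 := pick_bounds (f i) hτ
  have h2 : F.n * (GadgetEdge.pick (f i) τ).2 ≤ F.n * 20 := Nat.mul_le_mul_left _ h1.2
  simp only [labelColor]
  rw [mul_assoc]
  omega

theorem Valid.portColor_lt (hF : F.Valid) {c j : ℕ} (hc : c < F.m) (hj : j < 3) :
    F.lit c j + 2 * F.n * (F.slotIndex c j + 1) < 42 * F.n := by
  have h1 := hF.lit_lt c hc j hj
  have h2 := hF.slotIndex_lt hc hj
  have h3 : F.n * (F.slotIndex c j + 1) ≤ F.n * 12 := Nat.mul_le_mul_left _ (by omega)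
  rw [mul_assoc]
  omega

/-- Modulo `2 n` a gadget color reveals its variable, so equal colors occur only within one gadget,
where `pick_ne` applies. -/
theorem labelColor_inl_ne_inl (T : ℕ → ℕ) (f : ℕ → Bool) (g : ℕ → ℕ) {i i' : ℕ}
    {τ τ' : GadgetEdge} (h : i < F.n ∧ τ ∈ GadgetEdge.all) (h' : i' < F.n ∧ τ' ∈ GadgetEdge.all)
    (hne : (.inl (i, τ) : Label) ≠ .inl (i', τ'))
    (hsh : F.left (.inl (i, τ)) = F.left (.inl (i', τ')) ∨
      F.left (.inl (i, τ)) = F.right T (.inl (i', τ')) ∨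
      F.right T (.inl (i, τ)) = F.left (.inl (i', τ')) ∨
      F.right T (.inl (i, τ)) = F.right T (.inl (i', τ'))) :
    F.labelColor f g (.inl (i, τ)) ≠ F.labelColor f g (.inl (i', τ')) := by
  intro heq
  simp only [labelColor] at heq
  have h1 := pick_bounds (f i) h.2
  have h2 := pick_bounds (f i') h'.2
  have h3 := eq_of_add_mul_eq (by omega) (by omega) heq
  have hi : i = i' := by omega
  subst hi
  have hlo := (GadgetEdge.bounds τ h.2).1
  have hhi := (GadgetEdge.bounds τ h.2).2.1
  have hlo' := (GadgetEdge.bounds τ' h'.2).1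
  have hhi' := (GadgetEdge.bounds τ' h'.2).2.1
  refine GadgetEdge.pick_ne (f i) h.2 h'.2 ?_ (fun h => hne (by rw [h]))
    (Prod.ext (by omega) h3.2)
  have hk : ∀ {x x' k k' : ℕ}, k < 63 → k' < 63 → 63 * x + k = 63 * x' + k' → k = k' := by omega
  rcases hsh with h | h | h | h
  · exact Or.inl (hk (hlo.trans hhi) (hlo'.trans hhi') h)
  · exact Or.inr (Or.inl (hk (hlo.trans hhi) hhi' h))
  · exact Or.inr (Or.inr (Or.inl (hk hhi (hlo'.trans hhi') h)))
  · exact Or.inr (Or.inr (Or.inr (hk hhi hhi' h)))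

/-- A conflict could only involve the literal color at the port, in the gadget of the literal's own
variable. There the gadget uses the color of the opposite literal, as the literal `g c` is true. -/
theorem Valid.labelColor_inl_ne_inr (hF : F.Valid) (T : ℕ → ℕ) {f : ℕ → Bool} {g : ℕ → ℕ}
    {i c j : ℕ} {τ : GadgetEdge} (hb : i < F.n ∧ τ ∈ GadgetEdge.all) (hb' : c < F.m ∧ j < 3)
    (hg : f (F.var c (g c)) = decide (F.lit c (g c) % 2 = 0))
    (hsh : F.left (.inl (i, τ)) = F.left (.inr (c, j)) ∨
      F.left (.inl (i, τ)) = F.right T (.inr (c, j)) ∨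
      F.right T (.inl (i, τ)) = F.left (.inr (c, j)) ∨
      F.right T (.inl (i, τ)) = F.right T (.inr (c, j))) :
    F.labelColor f g (.inl (i, τ)) ≠ F.labelColor f g (.inr (c, j)) := by
  intro heq
  have h1 := labelColor_inl_lt f g hb.1 hb.2
  by_cases hj : j = g c
  · simp only [labelColor] at heq
    rw [if_pos hj] at heq
    have h2 := pick_bounds (f i) hb.2
    have h3 := eq_of_add_mul_eq (by omega) (hF.lit_lt c hb'.1 j hb'.2) heq
    have h4 := GadgetEdge.bounds τ hb.2
    have h5 := layerIndex_lt hb.1 τ.lo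
    have h6 := layerIndex_lt hb.1 τ.hi
    have h7 := hF.slotIndex_lt hb'.1 hb'.2
    simp only [left, right, port] at hsh
    have h8 := GadgetEdge.pick_fst_of_port (f i) τ hb.2 _ h7 h3.2 (by omega)
    have hi : F.var c j = i := by
      unfold var
      omega
    rw [← hj, hi] at hg
    rw [h8, hg] at h3
    by_cases h10 : F.lit c j % 2 = 0
    · simp only [h10, decide_true, if_true] at h3
      omega
    · simp only [h10, decide_false, Bool.false_eq_true, if_false] at h3
      omega
  · simp only [labelColor] at heq h1
    rw [if_neg hj] at heq
    omega

/-- These colors differ even without a common endpoint: a literal color determines variable and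
diamond, hence the occurrence, while a private color determines the clause and which of its two
other edges is meant. -/
theorem Valid.labelColor_inr_ne_inr (hF : F.Valid) (f : ℕ → Bool) {g : ℕ → ℕ} {c c' j j' : ℕ}
    (h : c < F.m ∧ j < 3) (h' : c' < F.m ∧ j' < 3) (hg : g c < 3)
    (hcj : ¬ (c = c' ∧ j = j')) :
    F.labelColor f g (.inr (c, j)) ≠ F.labelColor f g (.inr (c', j')) := by
  intro heq
  have h1 := hF.portColor_lt h.1 h.2
  have h2 := hF.portColor_lt h'.1 h'.2
  simp only [labelColor] at heq
  by_cases hj : j = g c <;> by_cases hj' : j' = g c'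
  · rw [if_pos hj, if_pos hj'] at heq
    have h3 := eq_of_add_mul_eq (hF.lit_lt c h.1 j h.2) (hF.lit_lt c' h'.1 j' h'.2) heq
    exact hcj (eq_of_var_of_slotIndex h.2 h'.2 (by rw [var, var, h3.1]) (by omega))
  · rw [if_pos hj, if_neg hj'] at heq
    omega
  · rw [if_neg hj, if_pos hj'] at heq
    omega
  · rw [if_neg hj, if_neg hj'] at heq
    clear h1 h2
    have hcc : c = c' := by split_ifs at heq <;> omega
    subst hcc
    refine hcj ⟨rfl, ?_⟩
    split_ifs at heq <;> omega

theorem Valid.isLabelColoring (hF : F.Valid) (T : ℕ → ℕ) {f : ℕ → Bool}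
    {g : ℕ → ℕ} (hg : ∀ c < F.m, g c < 3 ∧ f (F.var c (g c)) = decide (F.lit c (g c) % 2 = 0)) :
    IsLabelColoring F.labels F.left (F.right T) F.colors (F.labelColor f g) := by
  refine ⟨?_, ?_⟩
  · rintro (⟨i, τ⟩ | ⟨c, j⟩) h
    · rw [mem_labels_inl] at h
      simp only [labelColor, colors]
      rcases GadgetEdge.pick_mem (f i) τ h.2 with h2 | h2 <;> rw [h2] <;> simp
    · simp only [labelColor, colors]
      split_ifs <;> simp
  · rintro (⟨i, τ⟩ | ⟨c, j⟩) h (⟨i', τ'⟩ | ⟨c', j'⟩) h' hne hsh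
    · exact labelColor_inl_ne_inl T f g (mem_labels_inl.1 h) (mem_labels_inl.1 h') hne hsh
    · rw [mem_labels_inr] at h'
      exact hF.labelColor_inl_ne_inr T (mem_labels_inl.1 h) h' (hg _ h'.1).2 hsh
    · rw [mem_labels_inr] at h
      exact (hF.labelColor_inl_ne_inr T (mem_labels_inl.1 h') h (hg _ h.1).2 (by omega)).symm
    · rw [mem_labels_inr] at h h'
      exact hF.labelColor_inr_ne_inr f h h' (hg c h.1).1 fun hh => hne (by rw [hh.1, hh.2])

/-- In every coloring, the colors in the gadgets come from a satisfying assignment. -/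
theorem Valid.exists_satisfies (hF : F.Valid) {T : ℕ → ℕ} {col : Label → ℕ}
    (hc : IsLabelColoring F.labels F.left (F.right T) F.colors col) :
    ∃ f : ℕ → Bool, F.Satisfies f ∧ ∀ i < F.n, ∀ τ ∈ GadgetEdge.all, col (.inl (i, τ)) =
      2 * i + (GadgetEdge.pick (f i) τ).1 + 2 * F.n * (GadgetEdge.pick (f i) τ).2 := by
  have hex : ∀ i, ∃ f : Bool, i < F.n → ∀ τ ∈ GadgetEdge.all, col (.inl (i, τ)) =
      2 * i + (GadgetEdge.pick f τ).1 + 2 * F.n * (GadgetEdge.pick f τ).2 := by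
    intro i
    by_cases hi : i < F.n
    · obtain ⟨f, hf⟩ := GadgetEdge.exists_pick (n := F.n) (i := i) (col := fun τ => col (.inl (i, τ)))
        (fun τ hτ => by simpa [colors] using hc.1 _ (mem_labels_inl.2 ⟨hi, hτ⟩))
        (fun τ hτ τ' hτ' hne hm => hc.2 _ (mem_labels_inl.2 ⟨hi, hτ⟩) _
          (mem_labels_inl.2 ⟨hi, hτ'⟩) (by simpa using hne) (by
            simp only [left, right]
            rcases hm with h | h | h | h <;> simp [h]))
      exact ⟨f, fun _ => hf⟩
    · exact ⟨true, fun h => absurd h hi⟩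
  choose f hf using hex
  refine ⟨f, fun c hcm => ?_, hf⟩
  by_contra hcon
  push Not at hcon
  -- If every literal is false, each literal color is blocked at its port, and two private colors
  -- remain for three edges at the clause vertex.
  have hδ : ∀ j < 3, col (.inr (c, j)) = 42 * F.n + 2 * c ∨
      col (.inr (c, j)) = 42 * F.n + 2 * c + 1 := by
    intro j hj
    have hmem : col (.inr (c, j)) = F.lit c j + 2 * F.n * (F.slotIndex c j + 1) ∨
      col (.inr (c, j)) = 42 * F.n + 2 * c ∨ col (.inr (c, j)) = 42 * F.n + 2 * c + 1 := by
      simpa [colors] using hc.1 _ (mem_labels_inr.2 ⟨hcm, hj⟩)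
    refine hmem.resolve_left fun h => ?_
    obtain ⟨τ, hτ, hlo, hp⟩ := GadgetEdge.exists_pick_of_port (f (F.var c j)) _
      (hF.slotIndex_lt hcm hj)
    have hi := hF.var_lt hcm hj
    refine hc.2 _ (mem_labels_inl.2 ⟨hi, hτ⟩) _ (mem_labels_inr.2 ⟨hcm, hj⟩) (by simp) (Or.inl ?_) ?_
    · simp [left, port, hlo, layerIndex]
    · rw [hf _ hi τ hτ, hp, h]
      have h1 := hcon j hj
      have h2 : F.lit c j = 2 * F.var c j + F.lit c j % 2 := by
        unfold var
        omega
      rw [h2]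
      simp only
      congr 2
      rcases Nat.mod_two_eq_zero_or_one (F.lit c j) with h3 | h3 <;> simp [h3] at h1 <;>
        simp [h1, h3]
  have hne : ∀ j < 3, ∀ j' < 3, j ≠ j' → col (.inr (c, j)) ≠ col (.inr (c, j')) :=
    fun j hj j' hj' hjj => hc.2 _ (mem_labels_inr.2 ⟨hcm, hj⟩) _ (mem_labels_inr.2 ⟨hcm, hj'⟩)
      (by simpa using hjj) (Or.inr (Or.inr (Or.inr rfl)))
  have h0 := hδ 0 (by omega)
  have h1 := hδ 1 (by omega)
  have h2 := hδ 2 (by omega)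
  have h01 := hne 0 (by omega) 1 (by omega) (by omega)
  have h02 := hne 0 (by omega) 2 (by omega) (by omega)
  have h12 := hne 1 (by omega) 2 (by omega) (by omega)
  omega

end

end LitTable

/-! ### The layers, the alternating paths and the greedy choice of clause vertices -/

namespace LitTable

open ListEdgeColoringInstance

/-- The instance of the formula, where the clause `c` uses the vertex with index `T c`. -/
noncomputable def inst (F : LitTable) (T : ℕ → ℕ) : ListEdgeColoringInstance :=
  ofLabels (378 * side F.n) F.labels F.left (F.right T) F.colors

/-- The layer of a vertex. -/
def layerOf {N : ℕ} (v : Fin N) : Fin 63 := ⟨v % 63, Nat.mod_lt _ (by omega)⟩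

theorem layerOf_ne_of_adj {F : LitTable} (hF : F.Valid) {T : ℕ → ℕ} (hT : F.SlotsGood T F.m)
    {u v : Fin (F.inst T).numVertices} (h : (F.inst T).graph.Adj u v) : layerOf u ≠ layerOf v := by
  obtain ⟨l, hl, he⟩ := (mem_edgeSet_ofLabels (hF.validLabels hT) s(u, v)).1 h
  have key : F.left l % 63 ≠ F.right T l % 63 := by
    rcases l with ⟨i, τ⟩ | ⟨c, j⟩
    · have h1 := GadgetEdge.bounds τ (mem_labels_inl.1 hl).2
      simp only [left, right]
      omega
    · rw [mem_labels_inr] at hl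
      have h1 := hF.slotIndex_lt hl.1 hl.2
      simp only [left, right, port]
      omega
  intro hlay
  have hlay' : (u : ℕ) % 63 = (v : ℕ) % 63 := congrArg Fin.val hlay
  have he' : ((u : ℕ) = F.left l ∧ (v : ℕ) = F.right T l) ∨
      ((u : ℕ) = F.right T l ∧ (v : ℕ) = F.left l) := Sym2.eq_iff.1 he
  omega

theorem Valid.hasAlternatingPath {F : LitTable} (hF : F.Valid) {T : ℕ → ℕ}
    (hT : F.SlotsGood T F.m) {n : ℕ} (hn : n = F.n) (i : Fin n) :
    (F.inst T).HasAlternatingPath layerOf i := by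
  intro c hc
  have hV := hF.validLabels hT
  obtain ⟨col, hcol, hccol⟩ := exists_isLabelColoring hV hc
  obtain ⟨f, -, hf⟩ := hF.exists_satisfies hcol
  have hi : (i : ℕ) < F.n := hn ▸ i.2
  have hs := side_pos hi
  set f₀ := f i with hf₀
  let pos : ℕ → ℕ := fun k => 63 * layerIndex (side F.n) i k + k
  -- Truncation at 62 makes the vertex sequence total; only indices up to 62 are used.
  have hvlt : ∀ k, GadgetEdge.visit f₀ (min k 62) < 63 := fun k =>
    GadgetEdge.visit_lt _ (by omega)
  have hpos : ∀ k < 63, pos k < 378 * side F.n := fun k hk => by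
    have := layerIndex_lt hi k
    simp only [pos]
    omega
  let w : ℕ → Fin (F.inst T).numVertices := fun k =>
    ⟨pos (GadgetEdge.visit f₀ (min k 62)), hpos _ (hvlt k)⟩
  have hw : ∀ k ≤ 62, (w k : ℕ) = pos (GadgetEdge.visit f₀ k) := fun k hk => by
    simp only [w, min_eq_left hk]
  have hlay : ∀ k ≤ 62, (layerOf (w k) : ℕ) = GadgetEdge.visit f₀ k := fun k hk => by
    have h1 := GadgetEdge.visit_lt f₀ (k := k) (by omega)
    simp only [layerOf, hw k hk, pos]
    omega
  have hinj : ∀ k ≤ 62, ∀ k' ≤ 62, layerOf (w k) = layerOf (w k') → k = k' := by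
    intro k hk k' hk' h
    have h1 := congrArg Fin.val h
    rw [hlay k hk, hlay k' hk'] at h1
    rw [← GadgetEdge.visit_visit f₀ (k := k), h1, GadgetEdge.visit_visit]
  have hjoin : ∀ k < 62, ∀ τ : GadgetEdge,
      τ.Joins (GadgetEdge.visit f₀ k) (GadgetEdge.visit f₀ (k + 1)) →
      Sym2.map Fin.val s(w k, w (k + 1)) = s(F.left (.inl (i, τ)), F.right T (.inl (i, τ))) := by
    intro k hk τ h
    rw [Sym2.map_mk, hw k (by omega), hw (k + 1) (by omega), Sym2.eq_iff]
    rcases h with ⟨h1, h2⟩ | ⟨h1, h2⟩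
    · left; simp only [left, right, h1, h2, pos, and_self]
    · right; simp only [left, right, h1, h2, pos, and_self]
  obtain ⟨P, hsup, hedg⟩ := SimpleGraph.exists_walk_of_seq (F.inst T).graph w 62 (by
    intro k hk
    obtain ⟨τ, hτ, -, hj⟩ := GadgetEdge.exists_joins_visit f₀ k hk
    exact (mem_edgeSet_ofLabels hV s(w k, w (k + 1))).2
      ⟨_, mem_labels_inl.2 ⟨hi, hτ⟩, hjoin k hk τ hj⟩)
  have hpath : P.IsPath := by
    rw [SimpleGraph.Walk.isPath_def, hsup]
    refine List.nodup_range.map_on fun k hk k' hk' h => ?_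
    rw [List.mem_range] at hk hk'
    exact hinj k (by omega) k' (by omega) (by rw [h])
  refine ⟨w 0, w 62, P, hpath, ?_, ?_, ?_, ?_, ?_⟩
  · refine Fin.ext ?_
    rw [hlay 0 (by omega)]
    simp [GadgetEdge.visit]
  · refine Fin.ext ?_
    rw [hlay 62 (by omega)]
    simp [GadgetEdge.visit]
  · intro k
    have hk := GadgetEdge.visit_lt f₀ k.2
    refine ⟨w (GadgetEdge.visit f₀ k), ⟨?_, Fin.ext ?_⟩, ?_⟩
    · rw [hsup]
      exact List.mem_map.2 ⟨_, List.mem_range.2 hk, rfl⟩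
    · rw [hlay _ (by omega), GadgetEdge.visit_visit]
    · rintro y ⟨hy, hyk⟩
      rw [hsup] at hy
      obtain ⟨k', hk', rfl⟩ := List.mem_map.1 hy
      rw [List.mem_range] at hk'
      have h1 := congrArg Fin.val hyk
      rw [hlay k' (by omega)] at h1
      rw [← h1, GadgetEdge.visit_visit]
  · intro e
    obtain ⟨l, hl, he⟩ := (mem_edgeSet_ofLabels hV e.1).1 e.2
    rw [hccol e l hl he, hedg]
    simp only [ThreeFourSAT.literalCode, if_true, Bool.false_eq_true, if_false, List.mem_map,
      List.mem_range]
    constructor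
    · rintro ⟨k, hk, hke⟩
      obtain ⟨τ, hτ, hp, hj⟩ := GadgetEdge.exists_joins_visit f₀ k hk
      have h1 := hjoin k hk τ hj
      rw [hke] at h1
      obtain rfl := hV.inj l hl _ (mem_labels_inl.2 ⟨hi, hτ⟩) (he.symm.trans h1)
      rw [hf i hi τ hτ, ← hf₀, hp]
      have := (pick_bounds f₀ hτ).1
      omega
    · intro hcl
      rcases l with ⟨i', τ⟩ | ⟨c', j⟩
      · rw [mem_labels_inl] at hl
        have hb := (pick_bounds (f i') hl.2).1
        rw [hf i' hl.1 τ hl.2] at hcl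
        have h3 : i' = i ∧ (GadgetEdge.pick (f i') τ).2 = 0 := by
          rcases hcl with h | h
          · have := eq_of_add_mul_eq (M := 2 * F.n) (y' := 2 * i) (E' := 0) (by omega) (by omega)
              (h.trans (by omega))
            omega
          · have := eq_of_add_mul_eq (M := 2 * F.n) (y' := 2 * i + 1) (E' := 0) (by omega)
              (by omega) (h.trans (by omega))
            omega
        obtain ⟨rfl, hp⟩ := h3
        obtain ⟨k, hk, hj⟩ := GadgetEdge.exists_visit_joins f₀ τ hl.2 hp
        exact ⟨k, hk, Sym2.map.injective Fin.val_injective ((hjoin k hk τ hj).trans he.symm)⟩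
      -- Clause edges never carry the colors of a variable: their literal colors contain a positive
      -- multiple of `2 n`, and their private colors start at `42 n`.
      · exfalso
        have hm := hcol.1 _ hl
        rw [mem_labels_inr] at hl
        simp only [colors, List.mem_cons, List.not_mem_nil, or_false] at hm
        have : F.n ≤ F.n * (F.slotIndex c' j + 1) := Nat.le_mul_of_pos_right _ (by omega)
        rw [mul_assoc] at hm
        omega
  · intro k hk
    have hlen : P.edges.length = 62 := by rw [hedg]; simp
    have hnd := hpath.isTrail.edges_nodup
    -- Alternation is properness of the coloring at the common vertex of consecutive edges.
    refine hc.2 _ _ (fun h => ?_) ⟨w (k + 1), ?_, ?_⟩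
    · have := (List.Nodup.getElem_inj_iff hnd).1 (congrArg Subtype.val h)
      omega
    · simp [hedg]
    · simp [hedg]

theorem Valid.satisfies_iff {F : LitTable} (hF : F.Valid) {T : ℕ → ℕ} (hT : F.SlotsGood T F.m) :
    (∃ f, F.Satisfies f) ↔ (F.inst T).Colorable := by
  constructor
  · rintro ⟨f, hf⟩
    choose! g hg using hf
    exact colorable_ofLabels (hF.validLabels hT) (hF.isLabelColoring T hg)
  · rintro ⟨c, hc⟩
    obtain ⟨col, hcol, -⟩ := exists_isLabelColoring (hF.validLabels hT) hc
    obtain ⟨f, hf, -⟩ := hF.exists_satisfies hcol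
    exact ⟨f, hf⟩

/-- One of the first `3 s + 1` indices can be chosen for the next clause. -/
theorem Valid.exists_free {F : LitTable} (hF : F.Valid) (T : ℕ → ℕ) {k : ℕ} (hk : k < F.m) :
    ∃ t ≤ 3 * side F.n, ∀ c < k, ∀ j < 3, ∀ j' < 3, F.port c j = F.port k j' → T c ≠ t := by
  classical
  -- The earlier clauses that share the port of literal `j'`. They share it in the same position,
  -- since `slotIndex` modulo 3 is the position.
  let B : ℕ → Finset ℕ := fun j' =>
    (Finset.range k).filter fun c => ∃ j < 3, F.port c j = F.port k j'
  have hB : ∀ j' < 3, (B j').card ≤ side F.n := by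
    intro j' hj'
    have hmaps : ∀ c ∈ B j', c < k ∧ F.port c j' = F.port k j' := by
      intro c hc
      simp only [B, Finset.mem_filter, Finset.mem_range] at hc
      obtain ⟨hck, j, hj, hp⟩ := hc
      have h1 := (hF.eq_of_port (hck.trans hk) hk hj hj' hp).2
      have : j = j' := by
        unfold slotIndex at h1
        omega
      exact ⟨hck, this ▸ hp⟩
    calc (B j').card ≤ (Finset.range (side F.n)).card := by
          -- The port fixes the quotient of the variable by `s` and the slot, so the remainder
          -- determines the variable and then the clause.
          refine Finset.card_le_card_of_injOn (fun c => F.var c j' % side F.n) ?_ ?_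
          · intro c hc
            have hv := hF.var_lt ((hmaps c hc).1.trans hk) hj'
            exact Finset.mem_coe.2 (Finset.mem_range.2 (Nat.mod_lt _ (side_pos hv)))
          · intro c hc c' hc' hmod
            simp only at hmod
            have hp := hmaps c hc
            have hp' := hmaps c' hc'
            have h1 := hF.eq_of_port (hp.1.trans hk) (hp'.1.trans hk) hj' hj'
              (hp.2.trans hp'.2.symm)
            refine (eq_of_var_of_slotIndex hj' hj' ?_ h1.2).1
            rw [← Nat.div_add_mod (F.var c j') (side F.n), h1.1, hmod, Nat.div_add_mod]
      _ = side F.n := Finset.card_range _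
  let bad : Finset ℕ := (B 0 ∪ B 1 ∪ B 2).image T
  have hbad : bad.card < (Finset.range (3 * side F.n + 1)).card := by
    rw [Finset.card_range]
    have h0 := hB 0 (by omega)
    have h1 := hB 1 (by omega)
    have h2 := hB 2 (by omega)
    have h3 := Finset.card_union_le (B 0 ∪ B 1) (B 2)
    have h4 := Finset.card_union_le (B 0) (B 1)
    have h5 : bad.card ≤ (B 0 ∪ B 1 ∪ B 2).card := Finset.card_image_le
    omega
  obtain ⟨t, ht, htb⟩ := Finset.exists_mem_notMem_of_card_lt_card hbad
  refine ⟨t, by rw [Finset.mem_range] at ht; omega, ?_⟩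
  intro c hc j hj j' hj' hp hTc
  refine htb (Finset.mem_image.2 ⟨c, ?_, hTc⟩)
  have : c ∈ B j' := by
    simp only [B, Finset.mem_filter, Finset.mem_range]
    exact ⟨hc, j, hj, hp⟩
  simp only [Finset.mem_union]
  interval_cases j' <;> simp [this]

theorem SlotsGood.update {F : LitTable} {T : ℕ → ℕ} {k t : ℕ} (hT : F.SlotsGood T k)
    (ht : t ≤ 3 * side F.n)
    (hfree : ∀ c < k, ∀ j < 3, ∀ j' < 3, F.port c j = F.port k j' → T c ≠ t) :
    F.SlotsGood (Function.update T k t) (k + 1) := by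
  intro c hc
  rcases Nat.lt_succ_iff_lt_or_eq.1 hc with hck | rfl
  · rw [Function.update_of_ne hck.ne]
    refine ⟨(hT c hck).1, fun c' hc' hne j hj j' hj' hp => ?_⟩
    rcases Nat.lt_succ_iff_lt_or_eq.1 hc' with hck' | rfl
    · rw [Function.update_of_ne hck'.ne]
      exact (hT c hck).2 c' hck' hne j hj j' hj' hp
    · rw [Function.update_self]
      exact hfree c hck j hj j' hj' hp
  · rw [Function.update_self]
    refine ⟨ht, fun c' hc' hne j hj j' hj' hp => ?_⟩
    have hck' : c' < c := by omega
    rw [Function.update_of_ne hck'.ne]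
    exact (hfree c' hck' j' hj' j hj hp.symm).symm

/-- Sending a clause to its first variable has fibers of size at most 4. -/
theorem Valid.m_le {F : LitTable} (hF : F.Valid) : F.m ≤ 4 * F.n := by
  classical
  have h := Finset.card_le_mul_card_image_of_maps_to (s := Finset.range F.m)
    (t := Finset.range F.n) (f := fun c => F.var c 0)
    (fun c hc => Finset.mem_range.2 (hF.var_lt (Finset.mem_range.1 hc) (by omega))) 4 (by
      intro x hx
      refine le_trans (Finset.card_le_card ?_) (hF.occ_le x (Finset.mem_range.1 hx))
      intro c hc
      simp only [Finset.mem_filter] at hc ⊢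
      exact ⟨hc.1, 0, by omega, hc.2⟩)
  simpa using h

end LitTable

/-! ### Programs without loops, and a rule for loops -/

namespace RAM

/-- The program halts in the state `s'` after at most `T` steps. -/
def Runs (p : Prog) (s s' : State) (T : ℕ) : Prop := ∃ t ≤ T, Exec p s s' t

namespace Prog

/-- The final state of a program without loops. -/
def run : Prog → State → State
  | skip, s => s
  | assign x e, s => ⟨Function.update s.reg x (e.eval s), s.arr, s.out⟩
  | store a e f, s =>
      ⟨s.reg, Function.update s.arr a (Function.update (s.arr a) (e.eval s) (f.eval s)), s.out⟩
  | emit e, s => ⟨s.reg, s.arr, s.out ++ [e.eval s]⟩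
  | seq p q, s => q.run (p.run s)
  | ite e p q, s => if e.eval s ≠ 0 then p.run s else q.run s
  | loop _ _, s => s

/-- A bound on the number of steps of a program without loops. -/
def time : Prog → ℕ
  | skip => 1
  | assign _ e => e.cost + 1
  | store _ e f => e.cost + f.cost + 1
  | emit e => e.cost + 1
  | seq p q => p.time + q.time
  | ite e p q => e.cost + 1 + (p.time + q.time)
  | loop _ _ => 0

def LoopFree : Prog → Prop
  | seq p q => p.LoopFree ∧ q.LoopFree
  | ite _ p q => p.LoopFree ∧ q.LoopFree
  | loop _ _ => False
  | _ => True

def block (ps : List Prog) : Prog := ps.foldr seq skip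

end Prog

theorem Prog.LoopFree.runs {p : Prog} (hp : p.LoopFree) (s : State) :
    Runs p s (p.run s) p.time := by
  induction p generalizing s with
  | skip => exact ⟨_, le_rfl, .skip s⟩
  | assign x e => exact ⟨_, le_rfl, .assign x e s⟩
  | store a e f => exact ⟨_, le_rfl, .store a e f s⟩
  | emit e => exact ⟨_, le_rfl, .emit e s⟩
  | seq p q ihp ihq =>
    obtain ⟨t, ht, h⟩ := ihp hp.1 s
    obtain ⟨t', ht', h'⟩ := ihq hp.2 (p.run s)
    exact ⟨_, Nat.add_le_add ht ht', .seq h h'⟩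
  | ite e p q ihp ihq =>
    by_cases he : e.eval s = 0
    · obtain ⟨t, ht, h⟩ := ihq hp.2 s
      refine ⟨e.cost + 1 + t, by simp only [Prog.time]; omega, ?_⟩
      simp only [Prog.run, he, ne_eq, not_true_eq_false, if_false]
      exact .ite_false he h
    · obtain ⟨t, ht, h⟩ := ihp hp.1 s
      refine ⟨e.cost + 1 + t, by simp only [Prog.time]; omega, ?_⟩
      simp only [Prog.run, he, ne_eq, not_false_eq_true, if_true]
      exact .ite_true he h
  | loop e p => exact hp.elim

theorem Prog.loopFree_block {ps : List Prog} (h : ∀ p ∈ ps, p.LoopFree) :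
    (Prog.block ps).LoopFree := by
  induction ps with
  | nil => trivial
  | cons p ps ih =>
    exact ⟨h p List.mem_cons_self, ih fun q hq => h q (List.mem_cons_of_mem _ hq)⟩

theorem Runs.seq {p q : Prog} {s s' s'' : State} {T T' : ℕ} (h : Runs p s s' T)
    (h' : Runs q s' s'' T') : Runs (.seq p q) s s'' (T + T') := by
  obtain ⟨t, ht, h⟩ := h
  obtain ⟨t', ht', h'⟩ := h'
  exact ⟨_, Nat.add_le_add ht ht', .seq h h'⟩

theorem Runs.mono {p : Prog} {s s' : State} {T T' : ℕ} (h : Runs p s s' T) (hT : T ≤ T') :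
    Runs p s s' T' := by
  obtain ⟨t, ht, h⟩ := h
  exact ⟨t, ht.trans hT, h⟩

/-- A loop with an invariant that runs exactly `m` times. -/
theorem exists_runs_loop {e : Term} {p : Prog} {m B : ℕ} (Inv : ℕ → State → Prop)
    (hstep : ∀ k < m, ∀ s, Inv k s → e.eval s ≠ 0 ∧ ∃ s', Inv (k + 1) s' ∧ Runs p s s' B)
    (hdone : ∀ s, Inv m s → e.eval s = 0) {s : State} (hs : Inv 0 s) :
    ∃ s', Inv m s' ∧ Runs (.loop e p) s s' (m * (e.cost + 1 + B) + (e.cost + 1)) := by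
  -- Induction on the number `j` of remaining rounds.
  have key : ∀ j ≤ m, ∀ s, Inv (m - j) s →
      ∃ s', Inv m s' ∧ Runs (.loop e p) s s' (j * (e.cost + 1 + B) + (e.cost + 1)) := by
    intro j
    induction j with
    | zero =>
      intro _ s hs
      exact ⟨s, hs, _, by simp, .loop_done (hdone s hs)⟩
    | succ j ih =>
      intro hj s hs
      obtain ⟨he, s', hs', t, ht, hex⟩ := hstep (m - (j + 1)) (by omega) s hs
      obtain ⟨s'', hs'', t', ht', hex'⟩ := ih (by omega) s' (by
        rwa [show m - j = m - (j + 1) + 1 by omega])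
      refine ⟨s'', hs'', e.cost + 1 + t + t', ?_, .loop_step he hex hex'⟩
      rw [Nat.succ_mul]
      omega
  exact key m le_rfl s (by rwa [Nat.sub_self])

namespace Term

/-- Multiplication by a constant. -/
def smul (k : ℕ) (e : Term) : Term := Nat.rec (.const 0) (fun _ f => .add f e) k

theorem eval_smul (s : State) (k : ℕ) (e : Term) : (smul k e).eval s = k * e.eval s := by
  induction k with
  | zero => simp [smul, eval]
  | succ k ih =>
    have : (smul (k + 1) e).eval s = (smul k e).eval s + e.eval s := rfl
    rw [this, ih, Nat.succ_mul]

theorem eval_congr {s s' : State} (hr : s.reg = s'.reg) (ha : s.arr = s'.arr) (e : Term) :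
    e.eval s = e.eval s' := by
  induction e <;> simp_all [eval]

end Term

def emitAll (ts : List Term) : Prog := .block (ts.map .emit)

theorem run_emitAll (ts : List Term) (s : State) :
    (emitAll ts).run s = ⟨s.reg, s.arr, s.out ++ ts.map fun e => e.eval s⟩ := by
  induction ts generalizing s with
  | nil => simp [emitAll, Prog.block, Prog.run]
  | cons e ts ih =>
    have : (emitAll (e :: ts)).run s = (emitAll ts).run ((Prog.emit e).run s) := rfl
    rw [this, ih]
    simp only [Prog.run, List.map_cons, List.append_assoc, List.singleton_append]
    congr 3
    exact List.map_congr_left fun e _ => Term.eval_congr (s' := s) (by rfl) (by rfl) e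

theorem loopFree_emitAll (ts : List Term) : (emitAll ts).LoopFree :=
  Prog.loopFree_block fun p hp => by
    obtain ⟨e, _, rfl⟩ := List.mem_map.1 hp
    trivial

/-! ### The program for the reduction

Registers: `0` and `1` hold the numbers of variables and clauses, `2` the side `s`, `3` its square,
`4`, `5`, `6` the current variable `i` with `i / s` and `i % s`, `7` the current clause, `9` the
candidate index for its vertex and `10` the product of this index with the number of vertices;
`11`, `12`, `13` hold its literals and `14`, `15`, `16` their ports.

Arrays: `1` holds the variable of each literal, `2` the port of the next occurrence of each variable
as a first literal, `3` the color for this port, and `4` marks the used pairs of a port and an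
index. -/

open Term Prog

def initProg : Prog := block [assign 0 (read 0 (const 0)), assign 1 (read 0 (const 1))]

/-- Squares are updated by `(k + 1) ^ 2 = k ^ 2 + 2 k + 1`, with register `2` still holding `k`. -/
def sideBody : Prog :=
  block [assign 3 (add (add (reg 3) (smul 2 (reg 2))) (const 1)), assign 2 (add (reg 2) (const 1))]

def sideProg : Prog := loop (sub (reg 0) (reg 3)) sideBody

def headProg : Prog := emit (smul 378 (reg 2))

def indexTerm (k : ℕ) : Term :=
  if k % 3 = 0 then reg 5 else if k % 3 = 1 then reg 6 else add (reg 5) (reg 6)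

def gadgetTerms (τ : GadgetEdge) : List Term :=
  [add (smul 63 (indexTerm τ.lo)) (const τ.lo), add (smul 63 (indexTerm τ.hi)) (const τ.hi),
    const 2, add (smul 2 (reg 4)) (const τ.b),
    add (add (smul 2 (reg 4)) (const τ.aux)) (smul (2 * τ.e) (reg 0))]

/-- Quotient and remainder by `s` are kept as counters with a carry, so no division is needed. -/
def varUpdate : Prog :=
  block [store 1 (smul 2 (reg 4)) (reg 4), store 1 (add (smul 2 (reg 4)) (const 1)) (reg 4),
    store 2 (reg 4) (smul 63 (reg 5)), store 3 (reg 4) (smul 2 (reg 0)),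
    assign 4 (add (reg 4) (const 1)), assign 6 (add (reg 6) (const 1)),
    ite (sub (reg 2) (reg 6)) skip (block [assign 6 (const 0), assign 5 (add (reg 5) (const 1))])]

def varBody : Prog := seq (emitAll (GadgetEdge.all.flatMap gadgetTerms)) varUpdate

def varProg : Prog := loop (sub (reg 0) (reg 4)) varBody

def loadLiterals : Prog :=
  block [assign 11 (read 0 (add (smul 3 (reg 7)) (const 2))),
    assign 12 (read 0 (add (smul 3 (reg 7)) (const 3))),
    assign 13 (read 0 (add (smul 3 (reg 7)) (const 4))),
    assign 14 (read 2 (read 1 (reg 11))),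
    assign 15 (add (read 2 (read 1 (reg 12))) (const 3)),
    assign 16 (add (read 2 (read 1 (reg 13))) (const 6)),
    assign 9 (const 0), assign 10 (const 0)]

def searchCond : Term :=
  add (add (read 4 (add (reg 14) (reg 10))) (read 4 (add (reg 15) (reg 10))))
    (read 4 (add (reg 16) (reg 10)))

/-- The step `378 s` exceeds every port, so port plus offset encodes the pair of port and index
injectively. -/
def searchBody : Prog :=
  block [assign 9 (add (reg 9) (const 1)), assign 10 (add (reg 10) (smul 378 (reg 2)))]

def searchProg : Prog := loop searchCond searchBody

def clauseTerms (j : ℕ) : List Term :=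
  [reg (14 + j), add (smul 63 (add (smul 2 (reg 2)) (reg 9))) (const 1), const 3,
    add (reg (11 + j)) (add (read 3 (read 1 (reg (11 + j)))) (smul (2 * j) (reg 0))),
    add (smul 42 (reg 0)) (smul 2 (reg 7)),
    add (add (smul 42 (reg 0)) (smul 2 (reg 7))) (const 1)]

/-- A further occurrence moves a variable three diamonds ahead: `9` layers for the port and `3 * 2
n` for the color. -/
def mark (j : ℕ) : Prog :=
  block [store 4 (add (reg (14 + j)) (reg 10)) (const 1),
    store 2 (read 1 (reg (11 + j))) (add (read 2 (read 1 (reg (11 + j)))) (const 9)),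
    store 3 (read 1 (reg (11 + j)))
      (add (read 3 (read 1 (reg (11 + j)))) (smul 6 (reg 0)))]

def clauseUpdate : Prog := block [mark 0, mark 1, mark 2, assign 7 (add (reg 7) (const 1))]

def clauseEmit : Prog := emitAll ((List.range 3).flatMap clauseTerms)

def clauseBody : Prog := seq loadLiterals (seq searchProg (seq clauseEmit clauseUpdate))

def clauseProg : Prog := loop (sub (reg 1) (reg 7)) clauseBody

def program : Prog := seq initProg (seq sideProg (seq headProg (seq varProg clauseProg)))

end RAM

/-! ### The output word -/

namespace LitTable

/-- The description of an edge in the output. -/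
noncomputable def encode (F : LitTable) (T : ℕ → ℕ) (l : Label) : List ℕ :=
  F.left l :: F.right T l :: (F.colors l).length :: F.colors l

/-- The description of the gadget of the variable `i`. -/
noncomputable def gadgetOut (F : LitTable) (i : ℕ) : List ℕ :=
  GadgetEdge.all.flatMap fun τ => F.encode 0 (.inl (i, τ))

/-- The description of the edges of the clause `c`. -/
noncomputable def clauseOut (F : LitTable) (T : ℕ → ℕ) (c : ℕ) : List ℕ :=
  (List.range 3).flatMap fun j => F.encode T (.inr (c, j))

theorem flatMap_encode_labels (F : LitTable) (T : ℕ → ℕ) :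
    F.labels.flatMap (F.encode T) =
      (List.range F.n).flatMap F.gadgetOut ++ (List.range F.m).flatMap (F.clauseOut T) := by
  simp only [labels, List.flatMap_append, List.flatMap_map, SProd.sprod, List.product,
    List.flatMap_assoc]
  -- Gadget edges do not depend on `T`, so the `0` in `gadgetOut` is immaterial.
  rfl

end LitTable

/-! ### Invariants for the side and for the variable gadgets -/

namespace RAM

open Term Prog

theorem div_mod_succ {S k : ℕ} (hS : 0 < S) :
    (k % S + 1 < S → (k + 1) / S = k / S ∧ (k + 1) % S = k % S + 1) ∧
      (k % S + 1 = S → (k + 1) / S = k / S + 1 ∧ (k + 1) % S = 0) := by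
  have h := Nat.div_add_mod k S
  constructor
  · intro h1
    exact (Nat.div_mod_unique hS).2 ⟨by omega, h1⟩
  · intro h1
    exact (Nat.div_mod_unique hS).2 ⟨by rw [Nat.mul_add]; omega, hS⟩

structure VarInv (F : LitTable) (w : List ℕ) (k : ℕ) (s : State) : Prop where
  n : s.reg 0 = F.n
  m : s.reg 1 = F.m
  width : s.reg 2 = side F.n
  i : s.reg 4 = k
  div : s.reg 5 = k / side F.n
  mod : s.reg 6 = k % side F.n
  c : s.reg 7 = 0
  input : s.arr 0 = fun x => w.getD x 0
  half : ∀ x < 2 * k, s.arr 1 x = x / 2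
  base : ∀ x < k, s.arr 2 x = 63 * (x / side F.n)
  color : ∀ x < k, s.arr 3 x = 2 * F.n
  used : s.arr 4 = fun _ => 0
  out : s.out = 378 * side F.n :: (List.range k).flatMap F.gadgetOut

theorem VarInv.step {F : LitTable} {w : List ℕ} {k : ℕ} {s : State} (h : VarInv F w k s)
    (hk : k < F.n) : VarInv F w (k + 1) (varBody.run s) := by
  have hS := LitTable.side_pos hk
  have hout : (GadgetEdge.all.flatMap gadgetTerms).map (fun e => e.eval s) = F.gadgetOut k := by
    rw [List.map_flatMap]
    unfold LitTable.gadgetOut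
    congr 1
    funext τ
    have hidx : ∀ l, (indexTerm l).eval s = layerIndex (side F.n) k l := by
      intro l
      unfold indexTerm layerIndex
      split_ifs <;> simp [Term.eval, h.div, h.mod]
    simp only [gadgetTerms, List.map_cons, List.map_nil, Term.eval, eval_smul, hidx, h.i, h.n,
      LitTable.encode, LitTable.left, LitTable.right, LitTable.colors, List.length_cons,
      List.length_nil]
    rw [show 2 * τ.e * F.n = 2 * F.n * τ.e by ring]
  have hdm := div_mod_succ (k := k) hS
  have hmod := Nat.mod_lt k hS
  have hrun : varBody.run s =
      varUpdate.run ⟨s.reg, s.arr, s.out ++ F.gadgetOut k⟩ := by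
    unfold varBody
    rw [Prog.run, run_emitAll, hout]
  rw [hrun]
  have hb : ∀ x, x < 2 * (k + 1) → x ≠ 2 * k → x ≠ 2 * k + 1 → x < 2 * k := by omega
  have hb' : ∀ x, x < k + 1 → x ≠ k → x < k := by omega
  have hh : (2 * k + 1) / 2 = k := by omega
  rcases Nat.lt_or_ge (k % side F.n + 1) (side F.n) with hlt | hge
  · have hd := hdm.1 hlt
    have hne : side F.n - (k % side F.n + 1) ≠ 0 := by omega
    constructor
    all_goals
      simp (decide := true) only [varUpdate, block, List.foldr, Prog.run, Term.eval, eval_smul,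
        Function.update_of_ne, Function.update_self, ne_eq, not_false_eq_true, h.n, h.m, h.width,
        h.i, h.div, h.mod, h.c, h.input, h.used, hne, if_true, hd.1, hd.2, h.out]
    · intro x hx
      simp only [Function.update_apply]
      split_ifs with h1 h2
      · omega
      · omega
      · exact h.half x (hb x hx h2 h1)
    · intro x hx
      simp only [Function.update_apply]
      split_ifs with h1
      · rw [h1]
      · exact h.base x (hb' x hx h1)
    · intro x hx
      simp only [Function.update_apply]
      split_ifs with h1
      · rfl
      · exact h.color x (hb' x hx h1)
    · simp [List.range_succ]
  · have hd := hdm.2 (by omega)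
    have hne : side F.n - (k % side F.n + 1) = 0 := by omega
    constructor
    all_goals
      simp (decide := true) only [varUpdate, block, List.foldr, Prog.run, Term.eval, eval_smul,
        Function.update_of_ne, Function.update_self, ne_eq, h.n, h.m, h.width, h.i, h.div, h.mod,
        h.c, h.input, h.used, hne, if_false, hd.1, hd.2, h.out]
    · intro x hx
      simp only [Function.update_apply]
      split_ifs with h1 h2
      · omega
      · omega
      · exact h.half x (hb x hx h2 h1)
    · intro x hx
      simp only [Function.update_apply]
      split_ifs with h1
      · rw [h1]
      · exact h.base x (hb' x hx h1)
    · intro x hx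
      simp only [Function.update_apply]
      split_ifs with h1
      · rfl
      · exact h.color x (hb' x hx h1)
    · simp [List.range_succ]

theorem loopFree_varBody : varBody.LoopFree :=
  ⟨loopFree_emitAll _, by simp [varUpdate, block, LoopFree]⟩

theorem VarInv.loop {F : LitTable} {w : List ℕ} {s : State} (h : VarInv F w 0 s) :
    ∃ s', VarInv F w F.n s' ∧ Runs varProg s s' (F.n *
      ((sub (reg 0) (reg 4)).cost + 1 + varBody.time) + ((sub (reg 0) (reg 4)).cost + 1)) := by
  refine exists_runs_loop (VarInv F w) ?_ ?_ h
  · intro k hk s hs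
    exact ⟨by simp only [Term.eval, hs.n, hs.i]; omega, _, hs.step hk, loopFree_varBody.runs s⟩
  · intro s hs
    simp only [Term.eval, hs.n, hs.i]
    omega

structure StartInv (F : LitTable) (w : List ℕ) (k : ℕ) (s : State) : Prop where
  n : s.reg 0 = F.n
  m : s.reg 1 = F.m
  width : s.reg 2 = k
  sq : s.reg 3 = k * k
  zero : ∀ x, 4 ≤ x → s.reg x = 0
  input : s.arr 0 = fun x => w.getD x 0
  arr : ∀ x, 1 ≤ x → s.arr x = fun _ => 0
  out : s.out = []

theorem startInv_init {F : LitTable} {w : List ℕ} (h0 : w.getD 0 0 = F.n) (h1 : w.getD 1 0 = F.m) :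
    StartInv F w 0 (initProg.run (start w)) := by
  constructor
  all_goals
    simp (decide := true) only [initProg, block, List.foldr, Prog.run, Term.eval, start,
      Function.update_of_ne, Function.update_self, ne_eq, if_true, h0, h1]
  · intro x hx
    rw [Function.update_of_ne (by omega), Function.update_of_ne (by omega)]
  · intro x hx
    funext y
    rw [if_neg (by omega)]

theorem StartInv.step {F : LitTable} {w : List ℕ} {k : ℕ} {s : State} (h : StartInv F w k s) :
    StartInv F w (k + 1) (sideBody.run s) := by
  constructor
  all_goals
    simp (decide := true) only [sideBody, block, List.foldr, Prog.run, Term.eval, eval_smul,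
      Function.update_of_ne, Function.update_self, ne_eq, h.n, h.m, h.width,
      h.sq, h.input, h.out]
  · ring
  · intro x hx
    rw [Function.update_of_ne (by omega), Function.update_of_ne (by omega), h.zero x hx]
  · exact h.arr

theorem StartInv.loop {F : LitTable} {w : List ℕ} {s : State} (h : StartInv F w 0 s) :
    ∃ s', StartInv F w (side F.n) s' ∧
      Runs sideProg s s' (side F.n *
        ((sub (reg 0) (reg 3)).cost + 1 + sideBody.time) + ((sub (reg 0) (reg 3)).cost + 1)) := by
  refine exists_runs_loop (StartInv F w) ?_ ?_ h
  · intro k hk s hs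
    have := lt_of_lt_side hk
    exact ⟨by simp only [Term.eval, hs.n, hs.sq]; omega, _, hs.step,
      Prog.LoopFree.runs (by simp [sideBody, block, LoopFree]) s⟩
  · intro s hs
    have := le_side_mul_side F.n
    simp only [Term.eval, hs.n, hs.sq]
    omega

theorem StartInv.varInv {F : LitTable} {w : List ℕ} {s : State}
    (h : StartInv F w (side F.n) s) : VarInv F w 0 (headProg.run s) := by
  constructor
  all_goals simp [headProg, Prog.run, eval_smul, Term.eval, h.n, h.m, h.width, h.zero, h.input, h.arr,
    h.out]

end RAM

/-! ### Invariants for the clauses, and the running time -/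

namespace RAM

open Term Prog

/-- Only the values of `T` below `k` matter, so `T` may be redefined at `k` when the clause `k` is
placed. -/
structure ClauseInv (F : LitTable) (w : List ℕ) (T : ℕ → ℕ) (k : ℕ) (s : State) : Prop where
  n : s.reg 0 = F.n
  m : s.reg 1 = F.m
  width : s.reg 2 = side F.n
  c : s.reg 7 = k
  input : s.arr 0 = fun x => w.getD x 0
  half : ∀ x < 2 * F.n, s.arr 1 x = x / 2
  base : ∀ x < F.n, s.arr 2 x = 63 * (x / side F.n) + 9 * F.occ k x
  color : ∀ x < F.n, s.arr 3 x = 2 * F.n + 6 * F.n * F.occ k x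
  used : ∀ u < 378 * side F.n, ∀ t, s.arr 4 (u + 378 * side F.n * t) ≠ 0 ↔
    ∃ c < k, ∃ j < 3, F.port c j = u ∧ T c = t
  out : s.out = 378 * side F.n :: ((List.range F.n).flatMap F.gadgetOut ++
    (List.range k).flatMap (F.clauseOut T))

/-- The state while the index `t` is tried for the clause `k`. -/
structure SearchInv (F : LitTable) (w : List ℕ) (T : ℕ → ℕ) (k t : ℕ) (s : State) : Prop
    extends ClauseInv F w T k s where
  lit : ∀ j < 3, s.reg (11 + j) = F.lit k j
  port : ∀ j < 3, s.reg (14 + j) = F.port k j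
  index : s.reg 9 = t
  offset : s.reg 10 = 378 * side F.n * t

theorem VarInv.clauseInv {F : LitTable} {w : List ℕ} {s : State} (h : VarInv F w F.n s)
    (T : ℕ → ℕ) : ClauseInv F w T 0 s where
  n := h.n
  m := h.m
  width := h.width
  c := h.c
  input := h.input
  half := h.half
  base x hx := by simp [h.base x hx, LitTable.occ]
  color x hx := by simp [h.color x hx, LitTable.occ]
  used u _ t := by simp [h.used]
  out := by simp [h.out]

theorem ClauseInv.loadLiterals {F : LitTable} (hF : F.Valid) {w : List ℕ}
    (hw : ∀ c < F.m, ∀ j < 3, w.getD (3 * c + 2 + j) 0 = F.lit c j) {T : ℕ → ℕ} {k : ℕ}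
    (hk : k < F.m) {s : State} (h : ClauseInv F w T k s) :
    SearchInv F w T k 0 (loadLiterals.run s) := by
  have hbase : ∀ j < 3, s.arr 2 (s.arr 1 (F.lit k j)) + 3 * j = F.port k j := by
    intro j hj
    rw [h.half _ (hF.lit_lt k hk j hj), ← LitTable.var, h.base _ (hF.var_lt hk hj)]
    simp only [LitTable.port, LitTable.slotIndex]
    ring
  have w0 := hw k hk 0 (by omega)
  have w1 := hw k hk 1 (by omega)
  have w2 := hw k hk 2 (by omega)
  have b0 := hbase 0 (by omega)
  have b1 := hbase 1 (by omega)
  have b2 := hbase 2 (by omega)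
  simp only [Nat.add_zero, Nat.mul_zero, Nat.reduceMul, Nat.add_assoc, Nat.reduceAdd]
    at w0 w1 w2 b0 b1 b2
  refine ⟨⟨?_, ?_, ?_, ?_, ?_, ?_, ?_, ?_, ?_, ?_⟩, ?_, ?_, ?_, ?_⟩
  rotate_right 4
  · intro j hj
    interval_cases j <;>
    simp (decide := true) only [RAM.loadLiterals, block, List.foldr, Prog.run, Term.eval, eval_smul,
      Function.update_of_ne, Function.update_self, ne_eq, h.c, h.input, w0, w1, w2]
  · intro j hj
    interval_cases j <;>
    simp (decide := true) only [RAM.loadLiterals, block, List.foldr, Prog.run, Term.eval, eval_smul,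
      Function.update_of_ne, Function.update_self, ne_eq, h.c, h.input, w0, w1, w2, b0, b1, b2]
  all_goals
    simp (decide := true) only [RAM.loadLiterals, block, List.foldr, Prog.run, Term.eval,
      Function.update_of_ne, Function.update_self, ne_eq, Nat.mul_zero]
  exacts [h.n, h.m, h.width, h.c, h.input, h.half, h.base, h.color, h.used, h.out]

/-- The index `t` can be used for the clause `k`. -/
def Free (F : LitTable) (T : ℕ → ℕ) (k t : ℕ) : Prop :=
  ∀ c < k, ∀ j < 3, ∀ j' < 3, F.port c j = F.port k j' → T c ≠ t

theorem SearchInv.eval_searchCond {F : LitTable} (hF : F.Valid) {w : List ℕ} {T : ℕ → ℕ} {k t : ℕ}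
    (hk : k < F.m) {s : State} (h : SearchInv F w T k t s) :
    searchCond.eval s = 0 ↔ Free F T k t := by
  have hu : ∀ j < 3, s.arr 4 (F.port k j + 378 * side F.n * t) = 0 ↔
      ∀ c < k, ∀ j' < 3, F.port c j' = F.port k j → T c ≠ t := by
    intro j hj
    have h1 := hF.port_lt hk hj
    have := h.used (F.port k j) (by omega) t
    rw [← not_iff_not, ← ne_eq, this]
    push Not
    rfl
  have p0 := h.port 0 (by omega)
  have p1 := h.port 1 (by omega)
  have p2 := h.port 2 (by omega)
  simp only [Nat.add_zero, Nat.reduceAdd] at p0 p1 p2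
  simp only [searchCond, Term.eval, p0, p1, p2, h.offset, Nat.add_eq_zero_iff,
    hu 0 (by omega), hu 1 (by omega), hu 2 (by omega)]
  constructor
  · rintro ⟨⟨h0, h1⟩, h2⟩ c hc j hj j' hj' hp
    interval_cases j'
    · exact h0 c hc j hj hp
    · exact h1 c hc j hj hp
    · exact h2 c hc j hj hp
  · intro hf
    exact ⟨⟨fun c hc j hj => hf c hc j hj 0 (by omega), fun c hc j hj => hf c hc j hj 1 (by omega)⟩,
      fun c hc j hj => hf c hc j hj 2 (by omega)⟩

theorem SearchInv.step {F : LitTable} {w : List ℕ} {T : ℕ → ℕ} {k t : ℕ}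
    {s : State} (h : SearchInv F w T k t s) : SearchInv F w T k (t + 1) (searchBody.run s) := by
  refine ⟨⟨?_, ?_, ?_, ?_, ?_, ?_, ?_, ?_, ?_, ?_⟩, fun j hj => ?_, fun j hj => ?_, ?_, ?_⟩
  rotate_right 4
  · rw [← h.lit j hj]
    simp only [searchBody, block, List.foldr, Prog.run]
    rw [Function.update_of_ne (by omega), Function.update_of_ne (by omega)]
  · rw [← h.port j hj]
    simp only [searchBody, block, List.foldr, Prog.run]
    rw [Function.update_of_ne (by omega), Function.update_of_ne (by omega)]
  all_goals
    simp (decide := true) only [searchBody, block, List.foldr, Prog.run, Term.eval, eval_smul,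
      Function.update_of_ne, Function.update_self, ne_eq, h.index, h.offset, h.width]
  · ring
  exacts [h.n, h.m, h.c, h.input, h.half, h.base, h.color, h.used, h.out]

/-- The search stops at the least free index, which `exists_free` bounds by `3 s`. -/
theorem SearchInv.loop {F : LitTable} (hF : F.Valid) {w : List ℕ} {T : ℕ → ℕ} {k : ℕ}
    (hk : k < F.m) {s : State} (h : SearchInv F w T k 0 s) :
    ∃ t ≤ 3 * side F.n, Free F T k t ∧ ∃ s', SearchInv F w T k t s' ∧
      Runs searchProg s s' (3 * side F.n * (searchCond.cost + 1 + searchBody.time) +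
        (searchCond.cost + 1)) := by
  classical
  obtain ⟨t₀, ht₀, hfree⟩ := hF.exists_free T hk
  have hex : ∃ t, Free F T k t := ⟨t₀, hfree⟩
  have hle : Nat.find hex ≤ 3 * side F.n := (Nat.find_min' hex hfree).trans ht₀
  obtain ⟨s', hs', hr⟩ := exists_runs_loop (e := searchCond) (p := searchBody) (m := Nat.find hex)
    (B := searchBody.time) (SearchInv F w T k)
    (fun t ht s hs => ⟨fun h0 => Nat.find_min hex ht ((hs.eval_searchCond hF hk).1 h0),
      _, hs.step, Prog.LoopFree.runs (by simp [searchBody, block, LoopFree]) s⟩)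
    (fun s hs => (hs.eval_searchCond hF hk).2 (Nat.find_spec hex)) h
  exact ⟨_, hle, Nat.find_spec hex, s', hs', hr.mono (by gcongr)⟩

theorem run_mark (j : ℕ) (s : State) :
    ((mark j).run s).reg = s.reg ∧ ((mark j).run s).out = s.out ∧
    ((mark j).run s).arr 0 = s.arr 0 ∧ ((mark j).run s).arr 1 = s.arr 1 ∧
    ((mark j).run s).arr 2 = Function.update (s.arr 2) (s.arr 1 (s.reg (11 + j)))
      (s.arr 2 (s.arr 1 (s.reg (11 + j))) + 9) ∧
    ((mark j).run s).arr 3 = Function.update (s.arr 3) (s.arr 1 (s.reg (11 + j)))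
      (s.arr 3 (s.arr 1 (s.reg (11 + j))) + 6 * s.reg 0) ∧
    ((mark j).run s).arr 4 = Function.update (s.arr 4) (s.reg (14 + j) + s.reg 10) 1 := by
  simp (decide := true) only [mark, block, List.foldr, Prog.run, Term.eval, eval_smul,
    Function.update_of_ne, Function.update_self, ne_eq, and_self]

theorem update_three_apply (a : ℕ → ℕ) {u v w : ℕ} (huv : u ≠ v) (huw : u ≠ w) (hvw : v ≠ w)
    (δ x : ℕ) :
    Function.update (Function.update (Function.update a u (a u + δ)) v (a v + δ)) w (a w + δ) x =
      a x + if x = u ∨ x = v ∨ x = w then δ else 0 := by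
  simp only [Function.update_apply]
  split_ifs <;> simp_all

/-- The three variables of a clause are different, so the three updates do not interfere. -/
theorem run_clauseUpdate (s : State) {u v x : ℕ} (hu : s.arr 1 (s.reg 11) = u)
    (hv : s.arr 1 (s.reg 12) = v) (hx : s.arr 1 (s.reg 13) = x) (huv : u ≠ v) (hux : u ≠ x)
    (hvx : v ≠ x) :
    (clauseUpdate.run s).reg = Function.update s.reg 7 (s.reg 7 + 1) ∧
    (clauseUpdate.run s).out = s.out ∧
    (clauseUpdate.run s).arr 0 = s.arr 0 ∧ (clauseUpdate.run s).arr 1 = s.arr 1 ∧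
    (∀ y, (clauseUpdate.run s).arr 2 y = s.arr 2 y + if y = u ∨ y = v ∨ y = x then 9 else 0) ∧
    (∀ y, (clauseUpdate.run s).arr 3 y =
      s.arr 3 y + if y = u ∨ y = v ∨ y = x then 6 * s.reg 0 else 0) ∧
    (∀ y, (clauseUpdate.run s).arr 4 y = if y = s.reg 14 + s.reg 10 ∨ y = s.reg 15 + s.reg 10 ∨
      y = s.reg 16 + s.reg 10 then 1 else s.arr 4 y) := by
  obtain ⟨r0, o0, a00, a01, a02, a03, a04⟩ := run_mark 0 s
  obtain ⟨r1, o1, a10, a11, a12, a13, a14⟩ := run_mark 1 ((mark 0).run s)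
  obtain ⟨r2, o2, a20, a21, a22, a23, a24⟩ := run_mark 2 ((mark 1).run ((mark 0).run s))
  have hrun : clauseUpdate.run s =
      (assign 7 (add (reg 7) (const 1))).run ((mark 2).run ((mark 1).run ((mark 0).run s))) := rfl
  rw [hrun]
  simp only [Nat.add_zero, hu] at a02 a03 a04
  simp only [Nat.reduceAdd, r0, a01, hv] at a12 a13 a14
  simp only [Nat.reduceAdd, r1, r0, a11, a01, hx] at a22 a23 a24
  simp only [Prog.run, Term.eval, r2, r1, r0, o2, o1, o0, a20, a10, a00, a21, a11, a01, true_and]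
  refine ⟨fun y => ?_, fun y => ?_, fun y => ?_⟩
  · rw [a22, a12, a02, ← update_three_apply (s.arr 2) huv hux hvx]
    simp [huv.symm, hux.symm, hvx.symm]
  · rw [a23, a13, a03, ← update_three_apply (s.arr 3) huv hux hvx]
    simp [huv.symm, hux.symm, hvx.symm]
  · rw [a24, a14, a04]
    simp only [Function.update_apply]
    split_ifs <;> simp_all

theorem SearchInv.map_clauseTerms {F : LitTable} (hF : F.Valid) {w : List ℕ} {T : ℕ → ℕ} {k t : ℕ}
    (hk : k < F.m) {s : State} (h : SearchInv F w T k t s) :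
    ((List.range 3).flatMap clauseTerms).map (fun e => e.eval s) =
      F.clauseOut (Function.update T k t) k := by
  rw [List.map_flatMap]
  unfold LitTable.clauseOut
  refine List.flatMap_congr fun j hj => ?_
  rw [List.mem_range] at hj
  have hl := h.lit j hj
  have hp := h.port j hj
  have hh := h.half _ (hF.lit_lt k hk j hj)
  have hc := h.color _ (hF.var_lt hk hj)
  rw [LitTable.var] at hc
  simp only [clauseTerms, List.map_cons, List.map_nil, Term.eval, eval_smul, hl, hp, hh, hc, h.n,
    h.c, h.width, h.index, LitTable.encode, LitTable.left, LitTable.right, LitTable.colors,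
    Function.update_self, List.length_cons, List.length_nil, LitTable.slotIndex, LitTable.var]
  congr 4
  ring

theorem SearchInv.finish {F : LitTable} (hF : F.Valid) {w : List ℕ} {T : ℕ → ℕ} {k t : ℕ}
    (hk : k < F.m) {s : State} (h : SearchInv F w T k t s) :
    ClauseInv F w (Function.update T k t) (k + 1) (clauseUpdate.run (clauseEmit.run s)) := by
  have hout := h.map_clauseTerms hF hk
  have hemit : clauseEmit.run s = ⟨s.reg, s.arr, s.out ++ F.clauseOut (Function.update T k t) k⟩ := by
    rw [clauseEmit, run_emitAll, hout]
  have hhalf : ∀ j < 3, s.arr 1 (s.reg (11 + j)) = F.var k j := fun j hj => by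
    rw [h.lit j hj, h.half _ (hF.lit_lt k hk j hj), LitTable.var]
  have hvar : ∀ j < 3, ∀ j' < 3, j ≠ j' → F.var k j ≠ F.var k j' := fun j hj j' hj' hne he =>
    hne (hF.var_inj k hk j hj j' hj' he)
  obtain ⟨hr, ho, h0, h1, h2, h3, h4⟩ := run_clauseUpdate (clauseEmit.run s)
    (u := F.var k 0) (v := F.var k 1) (x := F.var k 2)
    (by rw [hemit]; exact hhalf 0 (by omega)) (by rw [hemit]; exact hhalf 1 (by omega))
    (by rw [hemit]; exact hhalf 2 (by omega)) (hvar 0 (by omega) 1 (by omega) (by omega))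
    (hvar 0 (by omega) 2 (by omega) (by omega)) (hvar 1 (by omega) 2 (by omega) (by omega))
  have hex : ∀ x, (∃ j < 3, F.var k j = x) ↔ x = F.var k 0 ∨ x = F.var k 1 ∨ x = F.var k 2 := by
    intro x
    constructor
    · rintro ⟨j, hj, rfl⟩
      interval_cases j <;> simp
    · rintro (rfl | rfl | rfl)
      exacts [⟨0, by omega, rfl⟩, ⟨1, by omega, rfl⟩, ⟨2, by omega, rfl⟩]
  have hocc : ∀ x, F.occ (k + 1) x =
      F.occ k x + if x = F.var k 0 ∨ x = F.var k 1 ∨ x = F.var k 2 then 1 else 0 := fun x => by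
    rw [LitTable.occ_succ]
    simp only [hex]
  rw [hemit] at hr ho h0 h1 h2 h3 h4
  rw [hemit]
  constructor
  · rw [hr, Function.update_of_ne (by omega), h.n]
  · rw [hr, Function.update_of_ne (by omega), h.m]
  · rw [hr, Function.update_of_ne (by omega), h.width]
  · rw [hr, Function.update_self, h.c]
  · rw [h0, h.input]
  · rw [h1]
    exact h.half
  · intro x hx
    rw [h2, hocc, h.base x hx]
    split_ifs <;> ring
  · intro x hx
    rw [h3, hocc, h.color x hx, h.n]
    split_ifs <;> ring
  · intro u hu t'
    have hsplit : (∃ c < k + 1, ∃ j < 3, F.port c j = u ∧ Function.update T k t c = t') ↔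
        (∃ j < 3, F.port k j = u ∧ t = t') ∨ ∃ c < k, ∃ j < 3, F.port c j = u ∧ T c = t' := by
      constructor
      · rintro ⟨c, hc, j, hj, hp, ht⟩
        rcases Nat.lt_succ_iff_lt_or_eq.1 hc with hc | rfl
        · rw [Function.update_of_ne hc.ne] at ht
          exact Or.inr ⟨c, hc, j, hj, hp, ht⟩
        · rw [Function.update_self] at ht
          exact Or.inl ⟨j, hj, hp, ht⟩
      · rintro (⟨j, hj, hp, ht⟩ | ⟨c, hc, j, hj, hp, ht⟩)
        · exact ⟨k, by omega, j, hj, hp, by rw [Function.update_self, ht]⟩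
        · exact ⟨c, by omega, j, hj, hp, by rw [Function.update_of_ne hc.ne, ht]⟩
    have hcell : ∀ j < 3, u + 378 * side F.n * t' = s.reg (14 + j) + s.reg 10 ↔
        F.port k j = u ∧ t = t' := by
      intro j hj
      rw [h.port j hj, h.offset]
      constructor
      · intro he
        have hp := hF.port_lt hk hj
        have := LitTable.eq_of_add_mul_eq hu (by omega) he
        omega
      · rintro ⟨rfl, rfl⟩
        rfl
    rw [hsplit, ← h.used u hu t', h4]
    have c0 := hcell 0 (by omega)
    have c1 := hcell 1 (by omega)
    have c2 := hcell 2 (by omega)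
    simp only [Nat.add_zero, Nat.reduceAdd] at c0 c1 c2
    simp only [c0, c1, c2]
    have hj3 : (∃ j < 3, F.port k j = u ∧ t = t') ↔ (F.port k 0 = u ∧ t = t') ∨
        (F.port k 1 = u ∧ t = t') ∨ (F.port k 2 = u ∧ t = t') := by
      constructor
      · rintro ⟨j, hj, hh⟩
        interval_cases j
        exacts [Or.inl hh, Or.inr (Or.inl hh), Or.inr (Or.inr hh)]
      · rintro (hh | hh | hh)
        exacts [⟨0, by omega, hh⟩, ⟨1, by omega, hh⟩, ⟨2, by omega, hh⟩]
    rw [hj3]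
    split_ifs with hh
    · exact iff_of_true one_ne_zero (Or.inl hh)
    · exact ⟨Or.inr, fun hor => hor.resolve_left hh⟩
  · rw [ho]
    simp only [h.out, List.range_succ, List.flatMap_append, List.flatMap_cons, List.flatMap_nil,
      List.append_nil, List.cons_append, List.append_assoc]
    congr 3
    refine List.flatMap_congr fun c hc => ?_
    rw [List.mem_range] at hc
    simp only [LitTable.clauseOut, LitTable.encode, LitTable.right, LitTable.left,
      Function.update_of_ne hc.ne]

/-- A bound on the number of steps for one clause, for formulas with `n` variables. -/
def clauseTime (n : ℕ) : ℕ :=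
  loadLiterals.time + (3 * n * (searchCond.cost + 1 + searchBody.time) + (searchCond.cost + 1) +
    (clauseEmit.time + clauseUpdate.time))

theorem ClauseInv.step {F : LitTable} (hF : F.Valid) {w : List ℕ}
    (hw : ∀ c < F.m, ∀ j < 3, w.getD (3 * c + 2 + j) 0 = F.lit c j) {T : ℕ → ℕ} {k : ℕ}
    (hk : k < F.m) (hT : F.SlotsGood T k) {s : State} (h : ClauseInv F w T k s) :
    ∃ T' s', F.SlotsGood T' (k + 1) ∧ ClauseInv F w T' (k + 1) s' ∧
      Runs clauseBody s s' (clauseTime F.n) := by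
  obtain ⟨t, ht, hfree, s', hs', hr⟩ := (h.loadLiterals hF hw hk).loop hF hk
  refine ⟨_, _, hT.update ht hfree, hs'.finish hF hk, ?_⟩
  refine Runs.seq (Prog.LoopFree.runs (by simp [RAM.loadLiterals, block, LoopFree]) s)
    (Runs.seq (hr.mono ?_) (Runs.seq (Prog.LoopFree.runs (loopFree_emitAll _) s')
      (Prog.LoopFree.runs (by simp [clauseUpdate, mark, block, LoopFree]) _)))
  have := side_le F.n
  gcongr

theorem ClauseInv.loop {F : LitTable} (hF : F.Valid) {w : List ℕ}
    (hw : ∀ c < F.m, ∀ j < 3, w.getD (3 * c + 2 + j) 0 = F.lit c j) {s : State}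
    (h : ClauseInv F w 0 0 s) :
    ∃ s', (∃ T, F.SlotsGood T F.m ∧ ClauseInv F w T F.m s') ∧ Runs clauseProg s s'
      (F.m * ((sub (reg 1) (reg 7)).cost + 1 + clauseTime F.n) +
        ((sub (reg 1) (reg 7)).cost + 1)) := by
  refine exists_runs_loop (fun k s => ∃ T, F.SlotsGood T k ∧ ClauseInv F w T k s) ?_ ?_
    ⟨0, fun c hc => by omega, h⟩
  · rintro k hk s ⟨T, hT, hs⟩
    obtain ⟨T', s', hT', hs', hr⟩ := hs.step hF hw hk hT
    exact ⟨by simp only [Term.eval, hs.m, hs.c]; omega, s', ⟨T', hT', hs'⟩, hr⟩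
  · rintro s ⟨T, -, hs⟩
    simp only [Term.eval, hs.m, hs.c]
    omega

/-- The running time of the program, as a polynomial in the number of variables. -/
noncomputable def programTime : Polynomial ℕ :=
  .C initProg.time +
    (.X * .C ((sub (reg 0) (reg 3)).cost + 1 + sideBody.time) +
        .C ((sub (reg 0) (reg 3)).cost + 1) +
      (.C headProg.time +
        (.X * .C ((sub (reg 0) (reg 4)).cost + 1 + varBody.time) +
            .C ((sub (reg 0) (reg 4)).cost + 1) +
          (4 * .X * (.C ((sub (reg 1) (reg 7)).cost + 1) + (.C loadLiterals.time +
            (3 * .X * .C (searchCond.cost + 1 + searchBody.time) + .C (searchCond.cost + 1) +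
              .C (clauseEmit.time + clauseUpdate.time)))) +
            .C ((sub (reg 1) (reg 7)).cost + 1)))))

theorem exists_runs_program {F : LitTable} (hF : F.Valid) {w : List ℕ} (h0 : w.getD 0 0 = F.n)
    (h1 : w.getD 1 0 = F.m)
    (hw : ∀ c < F.m, ∀ j < 3, w.getD (3 * c + 2 + j) 0 = F.lit c j) :
    ∃ T s, F.SlotsGood T F.m ∧ Runs program (start w) s (programTime.eval F.n) ∧
      s.out = 378 * side F.n :: F.labels.flatMap (F.encode T) := by
  obtain ⟨s₁, hs₁, hr₁⟩ := (startInv_init h0 h1).loop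
  obtain ⟨s₂, hs₂, hr₂⟩ := hs₁.varInv.loop
  obtain ⟨s₃, ⟨T, hT, hs₃⟩, hr₃⟩ := (hs₂.clauseInv 0).loop hF hw
  refine ⟨T, s₃, hT, ?_, ?_⟩
  · refine Runs.mono (Runs.seq (Prog.LoopFree.runs (by simp [initProg, block, LoopFree]) _)
      (Runs.seq hr₁ (Runs.seq (Prog.LoopFree.runs (by simp [headProg, LoopFree]) _)
        (Runs.seq hr₂ hr₃)))) ?_
    have hside := side_le F.n
    have hm := hF.m_le
    simp only [programTime, Polynomial.eval_add, Polynomial.eval_mul, Polynomial.eval_C,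
      Polynomial.eval_X, Polynomial.eval_ofNat]
    unfold clauseTime
    gcongr
  · rw [hs₃.out, LitTable.flatMap_encode_labels]

end RAM

/-! ### The reduction -/

theorem List.getD_flatMap_const_length {α β : Type*} {f : α → List β} {q : ℕ}
    (hf : ∀ a, (f a).length = q) (l : List α) (d : β) {c j : ℕ} (hc : c < l.length) (hj : j < q) :
    (l.flatMap f).getD (q * c + j) d = (f l[c]).getD j d := by
  induction l generalizing c with
  | nil => simp at hc
  | cons a l ih =>
    rw [List.flatMap_cons]
    cases c with
    | zero => rw [List.getD_append _ _ _ _ (by rw [hf]; omega)]; simp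
    | succ c =>
      rw [List.getD_append_right _ _ _ _ (by rw [hf, Nat.mul_succ]; omega), hf]
      have : q * (c + 1) + j - q = q * c + j := by rw [Nat.mul_succ]; omega
      rw [this, ih (by simpa using hc)]
      simp

namespace ThreeFourSAT

def litTable (φ : ThreeFourSAT) : LitTable where
  n := φ.numVars
  m := φ.clauses.length
  lit c j := φ.word.getD (3 * c + 2 + j) 0

theorem litTable_lit (φ : ThreeFourSAT) {c : ℕ} (hc : c < φ.clauses.length) (j : Fin 3) :
    φ.litTable.lit c j = literalCode (φ.clauses[c] j) := by
  have h : φ.litTable.lit c j =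
      (φ.clauses.flatMap fun C => List.ofFn fun j => literalCode (C j)).getD (3 * c + j) 0 := by
    simp only [litTable, word]
    rw [show 3 * c + 2 + (j : ℕ) = 3 * c + j + 1 + 1 by omega, List.getD_cons_succ,
      List.getD_cons_succ]
  rw [h, List.getD_flatMap_const_length (by simp) _ _ hc j.2]
  fin_cases j <;> simp

theorem literalCode_div_two {n : ℕ} (l : Fin n × Bool) : literalCode l / 2 = l.1 := by
  unfold literalCode
  split_ifs <;> omega

theorem litTable_var (φ : ThreeFourSAT) {c : ℕ} (hc : c < φ.clauses.length) (j : Fin 3) :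
    φ.litTable.var c j = (φ.clauses[c] j).1 := by
  rw [LitTable.var, litTable_lit φ hc, literalCode_div_two]

theorem litTable_occ (φ : ThreeFourSAT) (x : Fin φ.numVars) {c : ℕ} (hc : c ≤ φ.clauses.length) :
    φ.litTable.occ c x = (φ.clauses.take c).countP (fun C => decide (∃ j, (C j).1 = x)) := by
  induction c with
  | zero => simp [LitTable.occ]
  | succ c ih =>
    rw [LitTable.occ_succ, ih (by omega), List.take_succ_eq_append_getElem (by omega),
      List.countP_append]
    congr 1
    have : (∃ j < 3, φ.litTable.var c j = x) ↔ ∃ j, (φ.clauses[c] j).1 = x := by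
      constructor
      · rintro ⟨j, hj, h⟩
        have := litTable_var φ (by omega : c < φ.clauses.length) ⟨j, hj⟩
        exact ⟨⟨j, hj⟩, Fin.ext (this.symm.trans h)⟩
      · rintro ⟨j, h⟩
        exact ⟨j, j.2, by rw [litTable_var φ (by omega), h]⟩
    simp only [this, List.countP_singleton, decide_eq_true_eq]

theorem litTable_valid (φ : ThreeFourSAT) : φ.litTable.Valid where
  lit_lt c hc j hj := by
    have h := litTable_lit φ hc ⟨j, hj⟩
    simp only at h
    rw [h]
    have := (φ.clauses[c] ⟨j, hj⟩).1.2
    simp only [literalCode, litTable]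
    split_ifs <;> omega
  var_inj c hc j hj j' hj' h := by
    have h1 := litTable_var φ hc ⟨j, hj⟩
    have h2 := litTable_var φ hc ⟨j', hj'⟩
    simp only at h1 h2
    rw [h1, h2] at h
    exact congrArg Fin.val
      (φ.three_variables φ.clauses[c] (List.getElem_mem _) (Fin.ext h))
  occ_le x hx := by
    have h := litTable_occ φ ⟨x, hx⟩ le_rfl
    rw [List.take_length] at h
    exact h.trans_le (φ.at_most_four _)

theorem satisfiable_iff (φ : ThreeFourSAT) : φ.Satisfiable ↔ ∃ f, φ.litTable.Satisfies f := by
  have key : ∀ (f : Fin φ.numVars → Bool) (g : ℕ → Bool), (∀ x : Fin φ.numVars, f x = g x) →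
      ∀ c (hc : c < φ.clauses.length) (j : Fin 3), (f (φ.clauses[c] j).1 = (φ.clauses[c] j).2 ↔
        g (φ.litTable.var c j) = decide (φ.litTable.lit c j % 2 = 0)) := by
    intro f g hfg c hc j
    rw [litTable_var φ hc, litTable_lit φ hc, hfg]
    have : decide (literalCode (φ.clauses[c] j) % 2 = 0) = (φ.clauses[c] j).2 := by
      unfold literalCode
      cases (φ.clauses[c] j).2 <;> simp
    rw [this]
  constructor
  · rintro ⟨f, hf⟩
    refine ⟨fun x => if h : x < φ.numVars then f ⟨x, h⟩ else true, fun c hc => ?_⟩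
    obtain ⟨j, hj⟩ := hf φ.clauses[c] (List.getElem_mem _)
    exact ⟨j, j.2, (key f (fun x => if h : x < φ.numVars then f ⟨x, h⟩ else true)
      (fun x => by simp) c hc j).1 hj⟩
  · rintro ⟨g, hg⟩
    refine ⟨fun x => g x, fun C hC => ?_⟩
    obtain ⟨c, hc, rfl⟩ := List.getElem_of_mem hC
    obtain ⟨j, hj, h⟩ := hg c hc
    exact ⟨⟨j, hj⟩, (key _ g (fun _ => rfl) c hc ⟨j, hj⟩).2 h⟩

end ThreeFourSAT

/-- By minimality `(side n - 1) ^ 2 < n`, and the missing `1` is at most `√n`. -/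
theorem side_le_two_mul_sqrt {n : ℕ} (hn : 1 ≤ n) : (side n : ℝ) ≤ 2 * Real.sqrt n := by
  have h1 : (1 : ℝ) ≤ Real.sqrt n := by
    rw [Real.one_le_sqrt]
    exact_mod_cast hn
  rcases Nat.eq_zero_or_pos (side n) with h | h
  · rw [h, Nat.cast_zero]
    positivity
  · have h2 : ((side n - 1 : ℕ) : ℝ) ≤ Real.sqrt n := by
      refine Real.le_sqrt_of_sq_le ?_
      have := lt_of_lt_side (n := n) (k := side n - 1) (by omega)
      rw [sq]
      exact_mod_cast this.le
    rw [Nat.cast_sub h, Nat.cast_one] at h2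
    linarith

theorem lemma4 :
    ∃ f : ThreeFourSAT → ListEdgeColoringInstance,
      ComputableInPolynomialTime f ∧
      (∀ φ : ThreeFourSAT, φ.Satisfiable ↔ (f φ).Colorable) ∧
      (∃ K : ℝ, ∀ φ : ThreeFourSAT, 1 ≤ φ.numVars →
        ((f φ).numVertices : ℝ) ≤ K * Real.sqrt φ.numVars) ∧
      ∀ φ : ThreeFourSAT, ∃ layer : Fin (f φ).numVertices → Fin 63,
        (∀ u v, (f φ).graph.Adj u v → layer u ≠ layer v) ∧
        ∀ i : Fin φ.numVars, (f φ).HasAlternatingPath layer i := by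
  -- `T φ` comes with the program's run on `φ`, so the instance below is the one that the program
  -- writes.
  choose T s hT hrun hout using fun φ : ThreeFourSAT =>
    RAM.exists_runs_program φ.litTable_valid (w := φ.word) rfl rfl fun _ _ _ _ => rfl
  -- The constant is `756 = 378 * 2`.
  refine ⟨fun φ => φ.litTable.inst (T φ), ⟨RAM.program, RAM.programTime, fun φ => ?_⟩,
    fun φ => ?_, ⟨756, fun φ hn => ?_⟩, fun φ => ⟨LitTable.layerOf, fun u v h => ?_, fun i => ?_⟩⟩
  · obtain ⟨t, ht, hex⟩ := hrun φ
    refine ⟨s φ, t, hex, ht, ?_⟩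
    rw [hout φ]
    exact ListEdgeColoringInstance.isDescribedBy_ofLabels (φ.litTable_valid.validLabels (hT φ))
  · rw [φ.satisfiable_iff]
    exact φ.litTable_valid.satisfies_iff (hT φ)
  · have h : ((φ.litTable.inst (T φ)).numVertices : ℝ) = 378 * (side φ.numVars : ℝ) := by
      simp only [LitTable.inst, ListEdgeColoringInstance.ofLabels, ThreeFourSAT.litTable]
      push_cast
      rfl
    rw [h]
    linarith [side_le_two_mul_sqrt hn]
  · exact LitTable.layerOf_ne_of_adj φ.litTable_valid (hT φ) h
  · exact φ.litTable_valid.hasAlternatingPath (hT φ) rfl i
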